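/- Let $\Omega\subset\mathbb R^2$ be a convex open set and let $\hat f:\mathbb R^2\to\mathbb R$ be a smooth function with compact support in $\Omega$. Let the pressure $p=p(\xi,z;t)$, $\xi\in\mathbb R^2$, $z\in\mathbb R$, $t\ge 0$, be a solution, in the sense of (tempered) distributions in $(\xi,z)$, of the three-dimensional wave equation $$\partial_{tt}p=\Delta_{\xi,z}\,p\quad(t>0),\qquad p(\xi,z;0)=\hat f(\xi)\,\delta(z),\qquad \partial_t p(\xi,z;0)=0;$$ that is, $p(\cdot;t)\in\mathcal S'(\mathbb R^3)$ for every $t\ge0$, and for every Schwartz function $\varphi$ on $\mathbb R^3$ the function $t\mapsto\langle p(\cdot;t),\varphi\rangle$ has the value $\int\hat f(\xi)\varphi(\xi,0)\,d\xi$ and the one-sided derivative $0$ at $t=0$, and is twice differentiable with second derivative $\langle\Delta p(\cdot;t),\varphi\rangle$ at every $t>0$. For a distribution $T$ on $\mathbb R^3$ and a continuous function $g$ on $\mathbb R^2$, $\int_{-\infty}^\infty T(\cdot,z)\,dz=g$ means that $\langle T,\psi\otimes\chi_n\rangle\to\int\psi g\,d\xi$ for every $\psi\in C_c^\infty(\mathbb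 R^2)$ and every sequence $\chi_n\in C_c^\infty(\mathbb R)$ each of whose derivatives is bounded uniformly in $n$ and which on every bounded interval is eventually equal to $1$. For $\xi\in\mathbb R^2$ and $r>0$ let $\mathcal M_2[\hat f](\xi;r)=\frac1{2\pi}\int_{S^1}\hat f(\xi+r\theta)\,ds(\theta)$ be the circular mean, and let $\mathcal A[\psi](y)=\int_{-\infty}^\infty\psi(\sqrt{x^2+y^2})\,dx$ be the Abel transform. Then the following hold. 1. The vertical integral $\tilde p(\xi;t)=\int_{-\infty}^\infty p(\xi,z;t)\,dz$ exists for all $t\ge0$ as a continuous function of $\xi\in\mathbb R^2$. The function $\tilde p$ is of class $C^2$ on $\mathbb R^2\times[0,\infty)$ and solves the two-dimensional wave equation $$\partial_{tt}\tilde p(\xi;t)=\Delta_\xi\tilde p(\xi;t)\quad(\xi\in\mathbb R^2,\ t>0),\qquad \tilde p(\xi;0)=\hat f(\xi),\qquad \partial_t\tilde p(\xi;0)=0\quad(\xi\in\mathbb R^2).$$ 2. For all $\xi\in\mathbb R^2$ and $r>0$, with $\tilde p_\xi(s)=s^{-2}\,\tilde p(\xi;1/s)$, $$\mathcal M_2[\hat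 f](\xi;r)=\frac1{\pi r}\,\mathcal A[\tilde p_\xi]\Big(\frac1r\Big)=\frac2\pi\int_0^r\frac{\tilde p(\xi;t)}{\sqrt{r^2-t^2}}\,dt,$$ where both integrals converge absolutely. 3. Consequently, the vertical line detector data $m_1(\xi;t)=\tilde p(\xi;t)$, $\xi\in\partial\Omega$, $t>0$, and the circular means of $\hat f$ with centres on $\partial\Omega$ determine each other: for $\xi\in\partial\Omega$, $$\mathcal M_2[\hat f](\xi;r)=\frac2\pi\int_0^r\frac{m_1(\xi;t)}{\sqrt{r^2-t^2}}\,dt\quad(r>0),\qquad m_1(\xi;t)=\partial_t\int_0^t\frac{r\,\mathcal M_2[\hat f](\xi;r)}{\sqrt{t^2-r^2}}\,dr\quad(t>0),$$ where the first integral converges absolutely and the derivative in the second formula exists. -/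

import Mathlib

open scoped SchwartzMap ContDiff Topology

noncomputable section

namespace Photoacoustic

/-- The illumination plane `ℝ²`, with points `ξ`. -/
abbrev Plane : Type := EuclideanSpace ℝ (Fin 2)

/-- Euclidean space `ℝ³ = ℝ² × ℝ` (with the Euclidean norm), with points `(ξ, z)`. -/
abbrev Space3 : Type := WithLp 2 (Plane × ℝ)

/-! ### The wave equation -/

/-- `p : [0, ∞) → 𝓢'(E)` solves the initial value problem `∂ₜₜ p = Δ p` for `t > 0`, `p(0) = f`,
`∂ₜ p(0) = 0` in the sense of (tempered) distributions: time derivatives are taken after pairing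
with an arbitrary test function, the one at time `0` is one-sided, and `Δ` is the distributional
Laplacian. Values of `p` at negative times play no role. -/
structure IsDistributionalWaveSolution {E : Type*} [NormedAddCommGroup E] [InnerProductSpace ℝ E]
    [FiniteDimensional ℝ E] (p : ℝ → 𝓢'(E, ℂ)) (f : 𝓢'(E, ℂ)) : Prop where
  initial_value : p 0 = f
  initial_velocity : ∀ φ : 𝓢(E, ℂ), HasDerivWithinAt (fun t => p t φ) 0 (Set.Ici 0) 0
  differentiable : ∀ φ : 𝓢(E, ℂ), ∀ t : ℝ, 0 < t → DifferentiableAt ℝ (fun s => p s φ) t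
  wave : ∀ φ : 𝓢(E, ℂ), ∀ t : ℝ, 0 < t →
    HasDerivAt (deriv fun s => p s φ) (Laplacian.laplacian (p t) φ) t

/-- `u : E × [0, ∞) → ℝ` is a classical (`C²` up to time `0`) solution of `∂ₜₜ u = Δ u` for `t > 0`,
`u(·; 0) = f`, `∂ₜ u(·; 0) = 0`. Values of `u` at negative times play no role. -/
structure IsClassicalWaveSolution {E : Type*} [NormedAddCommGroup E] [InnerProductSpace ℝ E]
    [FiniteDimensional ℝ E] (u : E → ℝ → ℝ) (f : E → ℝ) : Prop where
  smooth : ContDiffOn ℝ 2 (fun q : E × ℝ => u q.1 q.2) (Set.univ ×ˢ Set.Ici 0)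
  wave : ∀ x : E, ∀ t : ℝ, 0 < t →
    iteratedDeriv 2 (fun s => u x s) t = Laplacian.laplacian (fun y => u y t) x
  initial_value : ∀ x : E, u x 0 = f x
  initial_velocity : ∀ x : E, HasDerivWithinAt (fun s => u x s) 0 (Set.Ici 0) 0

/-! ### The initial pressure `f(ξ, z) = f̂(ξ) δ(z)` -/

/-- The inclusion `ξ ↦ (ξ, 0)` of the illumination plane. -/
def planeIncl : Plane →L[ℝ] Space3 :=
  ((WithLp.prodContinuousLinearEquiv 2 ℝ Plane ℝ).symm : (Plane × ℝ) →L[ℝ] Space3).comp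
    (ContinuousLinearMap.inl ℝ Plane ℝ)

theorem planeIncl_apply (ξ : Plane) : planeIncl ξ = WithLp.toLp 2 (ξ, (0 : ℝ)) := rfl

theorem antilipschitz_planeIncl : AntilipschitzWith 1 planeIncl :=
  AddMonoidHomClass.antilipschitz_of_bound planeIncl fun ξ => by
    simp [planeIncl_apply]

/-- Restriction `φ ↦ φ(·, 0)` of Schwartz functions to the illumination plane. -/
def restrictPlane : 𝓢(Space3, ℂ) →L[ℂ] 𝓢(Plane, ℂ) :=
  SchwartzMap.compCLMOfAntilipschitz ℂ planeIncl.hasTemperateGrowth antilipschitz_planeIncl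

/-- A real test function as a complex-valued Schwartz function. -/
def complexTest (g : Plane → ℝ) (hg : ContDiff ℝ ∞ g) (hc : HasCompactSupport g) :
    𝓢(Plane, ℂ) :=
  HasCompactSupport.toSchwartzMap (f := fun ξ => (g ξ : ℂ))
    (hc.comp_left (g := fun y : ℝ => (y : ℂ)) Complex.ofReal_zero)
    (Complex.ofRealCLM.contDiff.comp hg)

/-- The distribution `g(ξ) δ(z)` on `ℝ³`. -/
def planarSource (g : Plane → ℝ) (hg : ContDiff ℝ ∞ g) (hc : HasCompactSupport g) :
    𝓢'(Space3, ℂ) :=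
  PointwiseConvergenceCLM.precomp ℂ restrictPlane
    (SchwartzMap.toTemperedDistributionCLM Plane ℂ MeasureTheory.volume (complexTest g hg hc))

theorem planarSource_apply (g : Plane → ℝ) (hg : ContDiff ℝ ∞ g) (hc : HasCompactSupport g)
    (φ : 𝓢(Space3, ℂ)) :
    planarSource g hg hc φ = ∫ ξ : Plane, φ (WithLp.toLp 2 (ξ, (0 : ℝ))) * (g ξ : ℂ) := by
  change SchwartzMap.toTemperedDistributionCLM Plane ℂ MeasureTheory.volume (complexTest g hg hc)
    (restrictPlane φ) = _
  exact SchwartzMap.toTemperedDistributionCLM_apply_apply MeasureTheory.volume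
    (complexTest g hg hc) (restrictPlane φ)

/-! ### Integration of a distribution along the vertical lines -/

/-- The test function `(ξ, z) ↦ ψ(ξ) χ(z)`. -/
def testTensor (ψ : 𝓢(Plane, ℂ)) (hψ : HasCompactSupport ψ)
    (χ : 𝓢(ℝ, ℂ)) (hχ : HasCompactSupport χ) : 𝓢(Space3, ℂ) :=
  HasCompactSupport.toSchwartzMap (f := fun x : Space3 => ψ x.fst * χ x.snd)
    (by
      have hK : IsCompact (WithLp.toLp 2 '' (tsupport ψ ×ˢ tsupport χ) : Set Space3) :=
        (IsCompact.prod hψ hχ).image (WithLp.prod_continuous_toLp 2 Plane ℝ)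
      refine HasCompactSupport.intro hK fun x hx => ?_
      by_contra h
      refine hx ⟨(x.fst, x.snd), ⟨subset_tsupport _ ?_, subset_tsupport _ ?_⟩, rfl⟩
      · exact left_ne_zero_of_mul h
      · exact right_ne_zero_of_mul h)
    (by
      have h₁ : ContDiff ℝ ∞ fun x : Space3 => ψ x.fst :=
        (ψ.smooth ⊤).comp ((ContinuousLinearMap.fst ℝ Plane ℝ).comp
          (WithLp.prodContinuousLinearEquiv 2 ℝ Plane ℝ : Space3 →L[ℝ] Plane × ℝ)).contDiff
      have h₂ : ContDiff ℝ ∞ fun x : Space3 => χ x.snd :=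
        (χ.smooth ⊤).comp ((ContinuousLinearMap.snd ℝ Plane ℝ).comp
          (WithLp.prodContinuousLinearEquiv 2 ℝ Plane ℝ : Space3 →L[ℝ] Plane × ℝ)).contDiff
      exact h₁.mul h₂)

/-- An approximate unit: test functions `χₙ` on `ℝ`, each derivative of which is bounded uniformly
in `n`, and which on every bounded interval are eventually equal to `1`. -/
structure IsApproximateUnit (χ : ℕ → 𝓢(ℝ, ℂ)) : Prop where
  compact : ∀ n, HasCompactSupport (χ n)
  eventually_one : ∀ R : ℝ, ∀ᶠ n in Filter.atTop, ∀ z : ℝ, |z| ≤ R → χ n z = 1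
  bounded : ∀ k : ℕ, ∃ C : ℝ, ∀ n : ℕ, ∀ z : ℝ, ‖iteratedDeriv k (χ n) z‖ ≤ C

/-- `g(ξ) = ∫ T(ξ, z) dz`: the distribution `T` on `ℝ³` is integrable along the vertical lines and
its vertical integral is the continuous function `g`. That is, `⟨T, ψ ⊗ 1⟩ = ∫ ψ(ξ) g(ξ) dξ` for all
test functions `ψ`, where `⟨T, ψ ⊗ 1⟩` is the limit of `⟨T, ψ ⊗ χₙ⟩` along every approximate unit
`(χₙ)`. -/
def HasVerticalIntegral (T : 𝓢'(Space3, ℂ)) (g : Plane → ℝ) : Prop :=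
  Continuous g ∧ ∀ (ψ : 𝓢(Plane, ℂ)) (hψ : HasCompactSupport ψ) (χ : ℕ → 𝓢(ℝ, ℂ))
    (hχ : IsApproximateUnit χ),
    Filter.Tendsto (fun n => T (testTensor ψ hψ (χ n) (hχ.compact n))) Filter.atTop
      (𝓝 (∫ ξ : Plane, ψ ξ * (g ξ : ℂ)))

/-- `P(ξ; t) = ∫ p(ξ, z; t) dz` for all `ξ ∈ ℝ²` and `t ≥ 0`. -/
def IsVerticallyIntegrated (p : ℝ → 𝓢'(Space3, ℂ)) (P : Plane → ℝ → ℝ) : Prop :=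
  ∀ t : ℝ, 0 ≤ t → HasVerticalIntegral (p t) (fun ξ => P ξ t)

/-! ### Circular means and the Abel transform -/

/-- The circular mean `M₂[f](ξ; r)`, the mean value of `θ ↦ f(ξ + r θ)` over the unit circle. -/
def circularMean (f : Plane → ℝ) (ξ : Plane) (r : ℝ) : ℝ :=
  (2 * Real.pi)⁻¹ * ∫ α in (0 : ℝ)..(2 * Real.pi), f (ξ + r • !₂[Real.cos α, Real.sin α])

/-- The Abel transform `A[ψ](y) = ∫_{-∞}^{∞} ψ(√(x² + y²)) dx`. -/
def abelTransform (ψ : ℝ → ℝ) (y : ℝ) : ℝ :=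
  ∫ x : ℝ, ψ (Real.sqrt (x ^ 2 + y ^ 2))

end Photoacoustic

end

/-!
A difference `d` of two solutions vanishes: by the Banach–Steinhaus theorem a single continuous
seminorm controls `⟨d(t), ·⟩` on a bounded time interval, and on a test function `φ` whose inverse
Fourier transform has compact support the seminorms of `Δⁿφ` grow only geometrically. So
`yₙ(t) = ⟨d(t), Δⁿφ⟩` has second derivative `yₙ₊₁`, zero initial data and `‖yₙ‖ ≤ C Bⁿ`, which
forces `yₙ = 0`, and such `φ` are dense. Hence `p` is the wave whose Fourier transform at time `t`
is `cos (2π t |(k, κ)|)` times that of `f̂ ⊗ δ`.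

Tested against `ψ ⊗ χₙ`, the Fourier transforms of `χₙ` concentrate at `κ = 0`, where the symbol
becomes `cos (2π t |k|)`: the vertical integral `p̃` is the planar wave with initial value `f̂`.
The mean of the character `x ↦ exp (2πi ⟨k, x⟩)` over the circle of radius `r` about the origin is
the mean of `cos (2π |k| r sin φ)` over `φ`, so `M₂[f̂](ξ; r) = (2/π) ∫ p̃(ξ; r sin φ) dφ` over
`[0, π/2]`; the substitutions `t = r sin φ` and `x = tan φ / r` give the two Abel forms. The
inversion is Archimedes' hat-box theorem
`∫∫ sin α g(τ sin α sin φ) dφ dα = (π/2) ∫₀¹ g(τ v) dv` over `[0, π/2]²`, which Wallis' integrals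
verify for monomials and the Weierstrass approximation theorem extends to continuous `g`.
-/

noncomputable section

open Filter

namespace Photoacoustic

/-! ### Completeness of the Schwartz space and the Banach–Steinhaus theorem -/

section Completeness

variable {E F : Type*} [NormedAddCommGroup E] [NormedSpace ℝ E]
  [NormedAddCommGroup F] [NormedSpace ℝ F]

theorem exists_contDiff_tendsto_iteratedFDeriv [CompleteSpace F] {u : ℕ → E → F}
    (hu : ∀ n, ContDiff ℝ ∞ (u n))
    (hcauchy : ∀ l, UniformCauchySeqOn (fun n => iteratedFDeriv ℝ l (u n)) atTop Set.univ) :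
    ∃ v : E → F, ContDiff ℝ ∞ v ∧
      ∀ l x, Tendsto (fun n => iteratedFDeriv ℝ l (u n) x) atTop (𝓝 (iteratedFDeriv ℝ l v x)) := by
  choose g hg using fun l x =>
    cauchySeq_tendsto_of_complete ((hcauchy l).cauchySeq (Set.mem_univ x))
  have hunif : ∀ l, TendstoUniformly (fun n => iteratedFDeriv ℝ l (u n)) (g l) atTop := fun l =>
    tendstoUniformlyOn_univ.1 ((hcauchy l).tendstoUniformlyOn_of_tendsto fun x _ => hg l x)
  have htaylor : HasFTaylorSeriesUpTo (∞ : WithTop ℕ∞) (fun x => (g 0 x).curry0)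
      (fun x l => g l x) := by
    refine ⟨fun x => rfl, fun m _ x => ?_, fun m _ => ?_⟩
    · refine hasFDerivAt_of_tendstoUniformly (l := atTop) (f := fun n => iteratedFDeriv ℝ m (u n))
        (f' := fun n x => (iteratedFDeriv ℝ (m + 1) (u n) x).curryLeft)
        (g' := fun x => (g (m + 1) x).curryLeft) ?_ (fun n x => ?_) (hg m) x
      · exact (continuousMultilinearCurryLeftEquiv ℝ (fun _ : Fin (m + 1) => E) F).isometry
          |>.uniformContinuous.comp_tendstoUniformly (hunif (m + 1))
      · exact (contDiff_iff_ftaylorSeries.1 (hu n)).fderiv m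
          (by exact_mod_cast ENat.natCast_lt_top m) x
    · exact (hunif m).continuous (.of_forall fun n =>
        (hu n).continuous_iteratedFDeriv (by exact_mod_cast le_top))
  refine ⟨_, htaylor.contDiff, fun l x => ?_⟩
  rw [← htaylor.eq_iteratedFDeriv (m := l) (by exact_mod_cast le_top) x]
  exact hg l x

theorem iteratedFDeriv_schwartz_sub (f g : 𝓢(E, F)) (l : ℕ) (x : E) :
    iteratedFDeriv ℝ l (f - g) x = iteratedFDeriv ℝ l f x - iteratedFDeriv ℝ l g x :=
  iteratedFDeriv_sub_apply (f.smooth l).contDiffAt (g.smooth l).contDiffAt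

theorem exists_pow_mul_norm_iteratedFDeriv_sub_lt {u : ℕ → 𝓢(E, F)} (hu : CauchySeq u)
    (k l : ℕ) {ε : ℝ} (hε : 0 < ε) : ∃ N, ∀ m ≥ N, ∀ n ≥ N, ∀ x,
      ‖x‖ ^ k * ‖iteratedFDeriv ℝ l (u m) x - iteratedFDeriv ℝ l (u n) x‖ < ε := by
  have h := cauchySeq_iff_tendsto.1 hu
  rw [uniformity_eq_comap_nhds_zero_swapped, tendsto_comap_iff,
    (schwartz_withSeminorms ℝ E F).tendsto_nhds] at h
  have h_ev := h (k, l) ε hε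
  rw [eventually_atTop_prod_self] at h_ev
  obtain ⟨N, hN⟩ := h_ev
  refine ⟨N, fun m hm n hn x => ?_⟩
  rw [← iteratedFDeriv_schwartz_sub]
  exact ((u m - u n).le_seminorm ℝ k l x).trans_lt (by simpa using hN m n hm hn)

theorem exists_schwartz_of_forall_bound {v : E → F} (hv : ContDiff ℝ ∞ v)
    (happrox : ∀ k l, ∃ (w : 𝓢(E, F)) (C : ℝ), ∀ x,
      ‖x‖ ^ k * ‖iteratedFDeriv ℝ l w x - iteratedFDeriv ℝ l v x‖ ≤ C) :
    ∃ V : 𝓢(E, F), ⇑V = v := by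
  refine ⟨⟨v, hv, fun k l => ?_⟩, rfl⟩
  obtain ⟨w, C, hC⟩ := happrox k l
  refine ⟨C + SchwartzMap.seminorm ℝ k l w, fun x => ?_⟩
  calc ‖x‖ ^ k * ‖iteratedFDeriv ℝ l v x‖
      ≤ ‖x‖ ^ k * (‖iteratedFDeriv ℝ l w x - iteratedFDeriv ℝ l v x‖ +
          ‖iteratedFDeriv ℝ l w x‖) := by
        gcongr
        rw [norm_sub_rev]
        exact norm_le_norm_sub_add _ _
    _ ≤ C + SchwartzMap.seminorm ℝ k l w := by
        rw [mul_add]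
        exact add_le_add (hC x) (w.le_seminorm ℝ k l x)

theorem exists_tendsto_of_cauchySeq_schwartz [CompleteSpace F] {u : ℕ → 𝓢(E, F)}
    (hu : CauchySeq u) : ∃ v : 𝓢(E, F), Tendsto u atTop (𝓝 v) := by
  obtain ⟨v, hv, hlim⟩ := exists_contDiff_tendsto_iteratedFDeriv (fun n => (u n).smooth ⊤)
    fun l => Metric.uniformCauchySeqOn_iff.2 fun ε hε => by
      obtain ⟨N, hN⟩ := exists_pow_mul_norm_iteratedFDeriv_sub_lt hu 0 l hε
      exact ⟨N, fun m hm n hn x _ => by simpa [dist_eq_norm] using hN m hm n hn x⟩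
  have hclose : ∀ k l, ∀ ε > 0, ∃ N, ∀ n ≥ N, ∀ x,
      ‖x‖ ^ k * ‖iteratedFDeriv ℝ l (u n) x - iteratedFDeriv ℝ l v x‖ ≤ ε := by
    intro k l ε hε
    obtain ⟨N, hN⟩ := exists_pow_mul_norm_iteratedFDeriv_sub_lt hu k l hε
    refine ⟨N, fun n hn x => ?_⟩
    refine le_of_tendsto (((tendsto_const_nhds.sub (hlim l x)).norm).const_mul (‖x‖ ^ k)) ?_
    filter_upwards [eventually_ge_atTop N] with m hm using (hN n hn m hm x).le
  obtain ⟨V, rfl⟩ := exists_schwartz_of_forall_bound hv fun k l => by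
    obtain ⟨N, hN⟩ := hclose k l 1 one_pos
    exact ⟨u N, 1, hN N le_rfl⟩
  refine ⟨V, ((schwartz_withSeminorms ℝ E F).tendsto_nhds u V).2 fun kl ε hε => ?_⟩
  obtain ⟨N, hN⟩ := hclose kl.1 kl.2 (ε / 2) (half_pos hε)
  filter_upwards [eventually_ge_atTop N] with n hn
  refine (SchwartzMap.seminorm_le_bound ℝ kl.1 kl.2 (u n - V) (half_pos hε).le
    fun x => ?_).trans_lt (half_lt_self hε)
  rw [iteratedFDeriv_schwartz_sub]
  exact hN n hn x

instance isCountablyGenerated_uniformity_schwartz : (uniformity 𝓢(E, F)).IsCountablyGenerated :=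
  IsUniformAddGroup.uniformity_countably_generated

instance completeSpace_schwartz [CompleteSpace F] : CompleteSpace 𝓢(E, F) :=
  UniformSpace.complete_of_cauchySeq_tendsto fun _ hu => exists_tendsto_of_cauchySeq_schwartz hu

instance baireSpace_schwartz [CompleteSpace F] : BaireSpace 𝓢(E, F) := by
  let := UniformSpace.pseudoMetricSpace 𝓢(E, F)
  infer_instance

theorem exists_continuous_seminorm_of_pointwise_bounded {ι : Type*} {q : ι → 𝓢'(E, ℂ)}
    (hq : ∀ φ, BddAbove (Set.range fun i => ‖q i φ‖)) :
    ∃ P : Seminorm ℂ 𝓢(E, ℂ), Continuous P ∧ ∀ i φ, ‖q i φ‖ ≤ P φ := by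
  let s : ι → Seminorm ℂ 𝓢(E, ℂ) := fun i => (normSeminorm ℂ ℂ).comp (q i).toLinearMap
  have hs : BddAbove (Set.range s) := Seminorm.bddAbove_range_iff.2 hq
  refine ⟨⨆ i, s i, ?_, fun i φ => ?_⟩
  · rw [Seminorm.coe_iSup_eq hs]
    exact Seminorm.continuous_iSup _ (fun i => (q i).continuous.norm) hs
  · have hi : s i ≤ ⨆ i, s i := le_ciSup (f := s) hs i
    exact hi φ

end Completeness

/-! ### Uniqueness of solutions -/

section SecondOrderUniqueness

variable {F : Type*} [NormedAddCommGroup F] [NormedSpace ℝ F]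

theorem tendsto_deriv_nhdsGT_zero [CompleteSpace F] {y a : ℝ → F} {v : F} {T L : ℝ} (hT : 0 < T)
    (h₀ : HasDerivWithinAt y v (Set.Ici 0) 0) (h₁ : ∀ t, 0 < t → DifferentiableAt ℝ y t)
    (h₂ : ∀ t, 0 < t → HasDerivAt (deriv y) (a t) t) (hL : ∀ t ∈ Set.Ioc 0 T, ‖a t‖ ≤ L) :
    Tendsto (deriv y) (𝓝[>] 0) (𝓝 v) := by
  have hlip : LipschitzOnWith L.toNNReal (deriv y) (Set.Ioc 0 T) :=
    (convex_Ioc 0 T).lipschitzOnWith_of_nnnorm_hasDerivWithin_le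
      (fun t ht => (h₂ t ht.1).hasDerivWithinAt) fun t ht => by
        rw [← NNReal.coe_le_coe]
        exact (hL t ht).trans (Real.le_coe_toNNReal L)
  have hcauchy : Cauchy (map (deriv y) (𝓝[>] (0 : ℝ))) :=
    (cauchy_nhds.mono nhdsWithin_le_nhds).map_of_le hlip.uniformContinuousOn
      (le_principal_iff.2 (Ioc_mem_nhdsGT hT))
  obtain ⟨c, hc⟩ := CompleteSpace.complete hcauchy
  have hderiv : HasDerivWithinAt y c (Set.Ici 0) 0 :=
    hasDerivWithinAt_Ici_of_tendsto_deriv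
      (fun t ht => (h₁ t ht).differentiableWithinAt)
      (h₀.continuousWithinAt.mono Set.Ioi_subset_Ici_self) self_mem_nhdsWithin hc
  rwa [← (uniqueDiffWithinAt_Ici (0 : ℝ)).eq_deriv _ hderiv h₀]

theorem norm_le_exp_of_norm_deriv_le_exp {y y' : ℝ → F} {K lam T : ℝ} (hK : 0 ≤ K) (hlam : 0 < lam)
    (h₀ : Tendsto y (𝓝[>] 0) (𝓝 0)) (h₁ : ∀ t ∈ Set.Ioc 0 T, HasDerivAt y (y' t) t)
    (hbound : ∀ t ∈ Set.Ioc 0 T, ‖y' t‖ ≤ K * Real.exp (lam * t)) :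
    ∀ t ∈ Set.Ioc 0 T, ‖y t‖ ≤ K / lam * Real.exp (lam * t) := by
  intro t ht
  have hB : ∀ c s : ℝ, HasDerivAt (fun s => c + K / lam * Real.exp (lam * s))
      (K * Real.exp (lam * s)) s := fun c s => by
    refine HasDerivAt.congr_deriv
      ((((hasDerivAt_id s).const_mul lam).exp.const_mul (K / lam)).const_add c) ?_
    simp only [id_eq, mul_one]
    field_simp
  have hstart : ∀ᶠ ε in 𝓝[>] (0 : ℝ), ‖y t‖ ≤ ‖y ε‖ + K / lam * Real.exp (lam * t) := by
    filter_upwards [Ioc_mem_nhdsGT ht.1] with ε hε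
    have hsub : Set.Icc ε t ⊆ Set.Ioc 0 T := fun s hs => ⟨hε.1.trans_le hs.1, hs.2.trans ht.2⟩
    refine image_norm_le_of_norm_deriv_right_le_deriv_boundary (f := y) (f' := y')
      (fun s hs => (h₁ s (hsub hs)).continuousAt.continuousWithinAt)
      (fun s hs => (h₁ s (hsub (Set.Ico_subset_Icc_self hs))).hasDerivWithinAt) ?_ (hB ‖y ε‖)
      (fun s hs => hbound s (hsub (Set.Ico_subset_Icc_self hs))) ⟨hε.2, le_rfl⟩
    exact le_add_of_nonneg_right (by positivity)
  have hlim := h₀.norm.add_const (K / lam * Real.exp (lam * t))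
  rw [norm_zero, zero_add] at hlim
  exact ge_of_tendsto hlim hstart

theorem norm_le_exp_of_norm_deriv_deriv_le_exp [CompleteSpace F] {y a : ℝ → F} {K lam T : ℝ}
    (hK : 0 ≤ K) (hlam : 0 < lam) (hy : y 0 = 0) (h₀ : HasDerivWithinAt y 0 (Set.Ici 0) 0)
    (h₁ : ∀ t, 0 < t → DifferentiableAt ℝ y t) (h₂ : ∀ t, 0 < t → HasDerivAt (deriv y) (a t) t)
    (hbound : ∀ t ∈ Set.Ioc 0 T, ‖a t‖ ≤ K * Real.exp (lam * t)) :
    ∀ t ∈ Set.Ioc 0 T, ‖y t‖ ≤ K / lam ^ 2 * Real.exp (lam * t) := by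
  intro t ht
  have hy0 : Tendsto y (𝓝[>] 0) (𝓝 0) := by
    simpa [ContinuousWithinAt, hy] using h₀.continuousWithinAt.mono Set.Ioi_subset_Ici_self
  have hderiv0 : Tendsto (deriv y) (𝓝[>] 0) (𝓝 0) :=
    tendsto_deriv_nhdsGT_zero (T := T) (L := K * Real.exp (lam * T)) (ht.1.trans_le ht.2) h₀ h₁ h₂
      fun s hs => (hbound s hs).trans (by gcongr; exact hs.2)
  have hderiv := norm_le_exp_of_norm_deriv_le_exp hK hlam hderiv0 (fun s hs => h₂ s hs.1) hbound
  have h := norm_le_exp_of_norm_deriv_le_exp (div_nonneg hK hlam.le) hlam hy0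
    (fun s hs => (h₁ s hs.1).hasDerivAt) hderiv t ht
  rwa [div_div, ← sq] at h

/-- With the weight `exp (λ t)`, each integration gains a factor `1 / λ`; as `λ ^ 2 = 2 B`, two of
them make up for the growth `B` and leave a factor `1 / 2`. -/
theorem eq_zero_of_deriv_deriv_eq_succ_of_norm_le_pow [CompleteSpace F] {y : ℕ → ℝ → F}
    {B C T : ℝ} (hy : ∀ n, y n 0 = 0) (h₀ : ∀ n, HasDerivWithinAt (y n) 0 (Set.Ici 0) 0)
    (h₁ : ∀ n t, 0 < t → DifferentiableAt ℝ (y n) t)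
    (h₂ : ∀ n t, 0 < t → HasDerivAt (deriv (y n)) (y (n + 1) t) t) (hB : 0 < B) (hC : 0 ≤ C)
    (hbound : ∀ n, ∀ t ∈ Set.Ioc 0 T, ‖y n t‖ ≤ C * B ^ n) :
    ∀ n, ∀ t ∈ Set.Ioc 0 T, y n t = 0 := by
  set lam := Real.sqrt (2 * B)
  have hlam : 0 < lam := Real.sqrt_pos.2 (by positivity)
  have hlam_sq : lam ^ 2 = 2 * B := Real.sq_sqrt (by positivity)
  have key : ∀ m n, ∀ t ∈ Set.Ioc 0 T, ‖y n t‖ ≤ C * B ^ n * (1 / 2) ^ m * Real.exp (lam * t) := by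
    intro m
    induction m with
    | zero =>
      intro n t ht
      refine (hbound n t ht).trans ?_
      rw [pow_zero, mul_one]
      exact le_mul_of_one_le_right (by positivity) (Real.one_le_exp (by have := ht.1; positivity))
    | succ m ih =>
      intro n t ht
      have h := norm_le_exp_of_norm_deriv_deriv_le_exp (by positivity) hlam (hy n) (h₀ n) (h₁ n)
        (h₂ n) (ih (n + 1)) t ht
      convert! h using 2
      rw [hlam_sq]
      field_simp
      ring
  intro n t ht
  have hlim : Tendsto (fun m => C * B ^ n * (1 / 2 : ℝ) ^ m * Real.exp (lam * t)) atTop (𝓝 0) := by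
    simpa using ((tendsto_pow_atTop_nhds_zero_of_lt_one (r := (1 / 2 : ℝ)) (by norm_num)
      (by norm_num)).const_mul (C * B ^ n)).mul_const (Real.exp (lam * t))
  exact norm_le_zero_iff.1 (ge_of_tendsto' hlim fun m => key m n t ht)

end SecondOrderUniqueness

section Multiplication

variable {𝕜 E F : Type*} [NormedAddCommGroup E] [NormedSpace ℝ E] [NormedAddCommGroup F]
  [NormedSpace ℝ F] [NormedField 𝕜] [NormedSpace 𝕜 F] [SMulCommClass ℝ 𝕜 F]

theorem seminorm_smulLeftCLM_le {a : E → ℝ} (ha : a.HasTemperateGrowth) {C : ℝ} (hC : 0 ≤ C)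
    {j k l : ℕ} (hbound : ∀ i ≤ l, ∀ x, ‖iteratedFDeriv ℝ i a x‖ ≤ C * ‖x‖ ^ j) (φ : 𝓢(E, F)) :
    SchwartzMap.seminorm 𝕜 k l (SchwartzMap.smulLeftCLM F a φ) ≤
      2 ^ l * C * (Finset.Iic (k + j, l)).sup (schwartzSeminormFamily 𝕜 E F) φ := by
  set Q := (Finset.Iic (k + j, l)).sup (schwartzSeminormFamily 𝕜 E F)
  refine SchwartzMap.seminorm_le_bound 𝕜 k l _ (by positivity) fun x => ?_
  have hQ : ∀ i, ‖x‖ ^ (k + j) * ‖iteratedFDeriv ℝ (l - i) φ x‖ ≤ Q φ := fun i =>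
    (φ.le_seminorm 𝕜 (k + j) (l - i) x).trans <|
      Seminorm.le_finset_sup_apply (p := schwartzSeminormFamily 𝕜 E F) (i := (k + j, l - i))
        (Finset.mem_Iic.2 ⟨le_rfl, Nat.sub_le l i⟩)
  calc ‖x‖ ^ k * ‖iteratedFDeriv ℝ l (SchwartzMap.smulLeftCLM F a φ) x‖
      ≤ ‖x‖ ^ k * ∑ i ∈ Finset.range (l + 1),
          (l.choose i) * ‖iteratedFDeriv ℝ i a x‖ * ‖iteratedFDeriv ℝ (l - i) φ x‖ := by
        rw [SchwartzMap.smulLeftCLM_apply ha]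
        gcongr
        exact norm_iteratedFDeriv_smul_le (ha.1.of_le (mod_cast le_top)) (φ.smooth l) x le_rfl
    _ ≤ ‖x‖ ^ k * ∑ i ∈ Finset.range (l + 1),
          (l.choose i) * (C * ‖x‖ ^ j) * ‖iteratedFDeriv ℝ (l - i) φ x‖ := by
        gcongr with i hi
        exact hbound i (Finset.mem_range_succ_iff.1 hi) x
    _ = ∑ i ∈ Finset.range (l + 1),
          (l.choose i) * C * (‖x‖ ^ (k + j) * ‖iteratedFDeriv ℝ (l - i) φ x‖) := by
        rw [Finset.mul_sum]
        exact Finset.sum_congr rfl fun i _ => by ring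
    _ ≤ ∑ i ∈ Finset.range (l + 1), (l.choose i) * C * Q φ := by
        gcongr with i
        exact hQ i
    _ = 2 ^ l * C * Q φ := by
        rw [← Finset.sum_mul, ← Finset.sum_mul]
        exact_mod_cast congrArg (fun N : ℕ => (N : ℝ) * C * Q φ) (Nat.sum_range_choose l)

theorem norm_iteratedFDeriv_le_sup_seminorm (a : 𝓢(E, F)) {i l : ℕ} (hi : i ≤ l) (x : E) :
    ‖iteratedFDeriv ℝ i a x‖ ≤ (Finset.Iic (0, l)).sup (schwartzSeminormFamily ℝ E F) a :=
  (a.norm_iteratedFDeriv_le_seminorm ℝ i x).trans <|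
    Seminorm.le_finset_sup_apply (p := schwartzSeminormFamily ℝ E F) (i := (0, i))
      (Finset.mem_Iic.2 ⟨le_rfl, hi⟩)

theorem exists_sup_seminorm_smulLeftCLM_le (a : 𝓢(E, ℝ)) (m : ℕ × ℕ) :
    ∃ B, 0 < B ∧ ∀ φ : 𝓢(E, F),
      (Finset.Iic m).sup (schwartzSeminormFamily 𝕜 E F) (SchwartzMap.smulLeftCLM F a φ) ≤
        B * (Finset.Iic m).sup (schwartzSeminormFamily 𝕜 E F) φ := by
  set A := (Finset.Iic (0, m.2)).sup (schwartzSeminormFamily ℝ E ℝ) a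
  have hA : 0 ≤ A := apply_nonneg _ _
  refine ⟨2 ^ m.2 * (A + 1), by positivity, fun φ => ?_⟩
  refine Seminorm.finset_sup_apply_le (by positivity) fun kl hkl => ?_
  have hkm : kl ≤ m := Finset.mem_Iic.1 hkl
  have hbound : ∀ i ≤ kl.2, ∀ x, ‖iteratedFDeriv ℝ i a x‖ ≤ A * ‖x‖ ^ 0 := fun i hi x => by
    simpa using norm_iteratedFDeriv_le_sup_seminorm a (hi.trans hkm.2) x
  refine (seminorm_smulLeftCLM_le a.hasTemperateGrowth hA hbound φ).trans ?_
  have hsup : (Finset.Iic (kl.1 + 0, kl.2)).sup (schwartzSeminormFamily 𝕜 E F) φ ≤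
      (Finset.Iic m).sup (schwartzSeminormFamily 𝕜 E F) φ :=
    Finset.sup_mono (f := schwartzSeminormFamily 𝕜 E F)
      (Finset.Iic_subset_Iic.2 hkm) φ
  have hl : kl.2 ≤ m.2 := hkm.2
  gcongr
  · norm_num
  · linarith

theorem iterate_smulLeftCLM_apply {a : E → ℝ} (ha : a.HasTemperateGrowth) (φ : 𝓢(E, F)) (n : ℕ)
    (x : E) : (SchwartzMap.smulLeftCLM F a)^[n] φ x = a x ^ n • φ x := by
  induction n with
  | zero => simp
  | succ n ih =>
    rw [Function.iterate_succ_apply', SchwartzMap.smulLeftCLM_apply_apply ha, ih, smul_smul,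
      pow_succ']

end Multiplication

section

variable {E F : Type*} [NormedAddCommGroup E] [NormedSpace ℝ E] [NormedAddCommGroup F]
  [NormedSpace ℂ F]

theorem exists_seminorm_iterate_smulLeftCLM_le {P : Seminorm ℂ 𝓢(E, F)} (hP : Continuous P)
    (a : 𝓢(E, ℝ)) (φ : 𝓢(E, F)) :
    ∃ B C, 0 < B ∧ 0 ≤ C ∧ ∀ n, P ((SchwartzMap.smulLeftCLM F a)^[n] φ) ≤ C * B ^ n := by
  obtain ⟨s, K, -, hK⟩ := Seminorm.bound_of_continuous (schwartz_withSeminorms ℂ E F) P hP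
  set Q := (Finset.Iic (s.sup id)).sup (schwartzSeminormFamily ℂ E F)
  have hPQ : ∀ ψ, P ψ ≤ K * Q ψ := fun ψ => (hK ψ).trans <|
    mul_le_mul_of_nonneg_left (Finset.sup_mono (f := schwartzSeminormFamily ℂ E F)
      (fun i hi => Finset.mem_Iic.2 (Finset.le_sup (f := id) hi)) ψ) K.2
  obtain ⟨B, hB, hBQ⟩ := exists_sup_seminorm_smulLeftCLM_le (𝕜 := ℂ) (F := F) a (s.sup id)
  have hQ : ∀ n, Q ((SchwartzMap.smulLeftCLM F a)^[n] φ) ≤ B ^ n * Q φ := by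
    intro n
    induction n with
    | zero => simp
    | succ n ih =>
      rw [Function.iterate_succ_apply', pow_succ', mul_assoc]
      exact (hBQ _).trans (by gcongr)
  refine ⟨B, K * Q φ, hB, by positivity, fun n => (hPQ _).trans ?_⟩
  rw [mul_assoc, mul_comm (Q φ)]
  gcongr
  exact hQ n

end

section Density

variable {E F : Type*} [NormedAddCommGroup E] [NormedSpace ℝ E] [FiniteDimensional ℝ E]
  [NormedAddCommGroup F] [NormedSpace ℝ F]

/-- A smooth bump function as a Schwartz function. -/
def schwartzBump (χ : ContDiffBump (0 : E)) : 𝓢(E, ℝ) :=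
  χ.hasCompactSupport.toSchwartzMap χ.contDiff

theorem schwartzBump_apply (χ : ContDiffBump (0 : E)) (x : E) : schwartzBump χ x = χ x := rfl

theorem exists_schwartz_iterate_smulLeftCLM_eq {g : E → ℝ} (hg : g.HasTemperateGrowth)
    {φ : 𝓢(E, F)} (hφ : HasCompactSupport φ) :
    ∃ a : 𝓢(E, ℝ),
      ∀ n, (SchwartzMap.smulLeftCLM F g)^[n] φ = (SchwartzMap.smulLeftCLM F a)^[n] φ := by
  obtain ⟨R, hR⟩ := hφ.isBounded.subset_closedBall 0
  let χ : ContDiffBump (0 : E) := ⟨max R 1, max R 1 + 1, by positivity, lt_add_one _⟩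
  refine ⟨SchwartzMap.smulLeftCLM ℝ g (schwartzBump χ), fun n => ?_⟩
  ext x
  rw [iterate_smulLeftCLM_apply hg, iterate_smulLeftCLM_apply (SchwartzMap.hasTemperateGrowth _),
    SchwartzMap.smulLeftCLM_apply_apply hg, schwartzBump_apply]
  by_cases hx : φ x = 0
  · rw [hx, smul_zero, smul_zero]
  · rw [χ.one_of_mem_closedBall (Metric.closedBall_subset_closedBall (le_max_left R 1)
      (hR (subset_tsupport _ hx))), smul_eq_mul, mul_one]

theorem exists_norm_iteratedFDeriv_one_sub_bump_le (χ : ContDiffBump (0 : E)) (l : ℕ) :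
    ∃ M, 0 ≤ M ∧ ∀ i ≤ l, ∀ x, ‖iteratedFDeriv ℝ i (fun y => 1 - χ y) x‖ ≤ M * ‖x‖ := by
  set A := (Finset.Iic (0, l)).sup (schwartzSeminormFamily ℝ E ℝ) (schwartzBump χ)
  have hA : 0 ≤ A := apply_nonneg _ _
  have hr := χ.rIn_pos
  refine ⟨(1 + A) / χ.rIn, div_nonneg (add_nonneg zero_le_one hA) hr.le, fun i hi x => ?_⟩
  rcases lt_or_ge ‖x‖ χ.rIn with hx | hx
  · have hzero : (fun y => 1 - χ y) =ᶠ[𝓝 x] fun _ => 0 := by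
      filter_upwards [χ.eventuallyEq_one_of_mem_ball (mem_ball_zero_iff.2 hx)] with y hy
      rw [hy, Pi.one_apply, sub_self]
    rw [(hzero.iteratedFDeriv ℝ i).eq_of_nhds, iteratedFDeriv_fun_zero, Pi.zero_apply, norm_zero]
    positivity
  · have hone : ‖iteratedFDeriv ℝ i (fun _ : E => (1 : ℝ)) x‖ ≤ 1 := by
      rcases i.eq_zero_or_pos with rfl | hi0
      · simp
      · simp [iteratedFDeriv_const_of_ne hi0.ne']
    calc ‖iteratedFDeriv ℝ i (fun y => 1 - χ y) x‖
        = ‖iteratedFDeriv ℝ i (fun _ : E => (1 : ℝ)) x - iteratedFDeriv ℝ i χ x‖ := by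
          congr 1
          exact iteratedFDeriv_sub_apply contDiffAt_const χ.contDiffAt
      _ ≤ 1 + A := (norm_sub_le _ _).trans
          (add_le_add hone (norm_iteratedFDeriv_le_sup_seminorm (schwartzBump χ) hi x))
      _ ≤ (1 + A) / χ.rIn * ‖x‖ := by
          rw [div_mul_eq_mul_div, le_div_iff₀ hr]
          gcongr

theorem hasTemperateGrowth_bump_comp_smul (χ : ContDiffBump (0 : E)) {c : ℝ} (hc : c ≠ 0) :
    (fun x => χ (c • x)).HasTemperateGrowth :=
  (χ.hasCompactSupport.comp_smul hc).hasTemperateGrowth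
    (χ.contDiff.comp (contDiff_const_smul c))

theorem exists_seminorm_smulLeftCLM_bump_sub_le (χ : ContDiffBump (0 : E)) (k l : ℕ)
    (φ : 𝓢(E, F)) :
    ∃ C, ∀ c, 0 < c → c ≤ 1 → SchwartzMap.seminorm ℝ k l
      (SchwartzMap.smulLeftCLM F (fun x => χ (c • x)) φ - φ) ≤ C * c := by
  obtain ⟨M, hM, hbound⟩ := exists_norm_iteratedFDeriv_one_sub_bump_le χ l
  refine ⟨2 ^ l * M * (Finset.Iic (k + 1, l)).sup (schwartzSeminormFamily ℝ E F) φ,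
    fun c hc hc1 => ?_⟩
  have hχ : (fun x => 1 - χ (c • x)).HasTemperateGrowth :=
    (Function.HasTemperateGrowth.const 1).sub (hasTemperateGrowth_bump_comp_smul χ hc.ne')
  have hdiff : SchwartzMap.smulLeftCLM F (fun x => χ (c • x)) φ - φ =
      -SchwartzMap.smulLeftCLM F (fun x => 1 - χ (c • x)) φ := by
    ext x
    rw [sub_apply, neg_apply,
      SchwartzMap.smulLeftCLM_apply_apply (hasTemperateGrowth_bump_comp_smul χ hc.ne'),
      SchwartzMap.smulLeftCLM_apply_apply hχ, sub_smul, one_smul, neg_sub]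
  have hscaled : ∀ i ≤ l, ∀ x,
      ‖iteratedFDeriv ℝ i (fun y => 1 - χ (c • y)) x‖ ≤ M * c * ‖x‖ ^ 1 := fun i hi x => by
    rw [iteratedFDeriv_comp_const_smul (f := fun y => 1 - χ y) c
      (contDiff_const.sub χ.contDiff), norm_smul, norm_pow, Real.norm_of_nonneg hc.le]
    refine (mul_le_of_le_one_left (norm_nonneg _) (pow_le_one₀ hc.le hc1)).trans ?_
    refine (hbound i hi _).trans_eq ?_
    rw [norm_smul, Real.norm_of_nonneg hc.le, pow_one, mul_assoc]
  rw [hdiff, map_neg_eq_map]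
  exact (seminorm_smulLeftCLM_le hχ (mul_nonneg hM hc.le) hscaled φ).trans_eq (by ring)

theorem dense_setOf_hasCompactSupport_schwartz :
    Dense {φ : 𝓢(E, F) | HasCompactSupport φ} := by
  intro φ
  let χ : ContDiffBump (0 : E) := default
  let c : ℕ → ℝ := fun n => 1 / ((n : ℝ) + 1)
  have hc : ∀ n, 0 < c n := fun n => Nat.one_div_pos_of_nat
  have hc1 : ∀ n, c n ≤ 1 := fun n => by
    simpa [c] using inv_le_one_of_one_le₀ (le_add_of_nonneg_left n.cast_nonneg)
  refine mem_closure_of_tendsto (b := atTop)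
    (f := fun n => SchwartzMap.smulLeftCLM F (fun x => χ (c n • x)) φ) ?_
    (.of_forall fun n => ?_)
  · rw [(schwartz_withSeminorms ℝ E F).tendsto_nhds]
    intro kl ε hε
    obtain ⟨C, hC⟩ := exists_seminorm_smulLeftCLM_bump_sub_le χ kl.1 kl.2 φ
    have hlim : Tendsto (fun n => C * c n) atTop (𝓝 0) := by
      simpa only [mul_zero] using tendsto_one_div_add_atTop_nhds_zero_nat.const_mul C
    filter_upwards [hlim.eventually_lt_const hε] with n hn
    exact (hC (c n) (hc n) (hc1 n)).trans_lt hn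
  · exact (χ.hasCompactSupport.comp_smul (hc n).ne').mono' ((subset_tsupport _).trans
      ((SchwartzMap.tsupport_smulLeftCLM_subset _ φ).trans Set.inter_subset_right))

end Density

section Uniqueness

open scoped FourierTransform Laplacian

variable {E : Type*} [NormedAddCommGroup E] [InnerProductSpace ℝ E]

theorem hasTemperateGrowth_laplacian_symbol :
    (fun x : E => -(2 * Real.pi) ^ 2 * ‖x‖ ^ 2).HasTemperateGrowth :=
  (Function.HasTemperateGrowth.const _).mul (Function.hasTemperateGrowth_norm_sq E)

variable [FiniteDimensional ℝ E] [MeasurableSpace E] [BorelSpace E]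

theorem laplacian_fourierInv (φ : 𝓢(E, ℂ)) :
    Δ (𝓕⁻ φ) = 𝓕⁻ (SchwartzMap.smulLeftCLM ℂ (fun x : E => -(2 * Real.pi) ^ 2 * ‖x‖ ^ 2) φ) := by
  have hsymbol : SchwartzMap.smulLeftCLM ℂ (fun x : E => -(2 * Real.pi) ^ 2 * ‖x‖ ^ 2) φ =
      (-(2 * Real.pi) ^ 2) • SchwartzMap.smulLeftCLM ℂ (fun x : E => ‖x‖ ^ 2) φ := by
    ext x
    rw [SchwartzMap.smulLeftCLM_apply_apply hasTemperateGrowth_laplacian_symbol, smul_apply,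
      SchwartzMap.smulLeftCLM_apply_apply (Function.hasTemperateGrowth_norm_sq E), mul_smul]
  rw [SchwartzMap.laplacian_eq_fourierMultiplierCLM, SchwartzMap.fourierMultiplierCLM_apply,
    hsymbol, FourierTransform.fourier_fourierInv_eq, FourierTransform.fourierInv_smul]

theorem iterate_laplacian_fourierInv (φ : 𝓢(E, ℂ)) (n : ℕ) :
    (Δ : 𝓢(E, ℂ) → 𝓢(E, ℂ))^[n] (𝓕⁻ φ) =
      𝓕⁻ ((SchwartzMap.smulLeftCLM ℂ fun x : E => -(2 * Real.pi) ^ 2 * ‖x‖ ^ 2)^[n] φ) :=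
  (Function.Semiconj.iterate_right (f := (𝓕⁻ : 𝓢(E, ℂ) → 𝓢(E, ℂ)))
    (fun ψ => (laplacian_fourierInv ψ).symm) n φ).symm

theorem exists_seminorm_iterate_laplacian_fourierInv_le {P : Seminorm ℂ 𝓢(E, ℂ)}
    (hP : Continuous P) {φ : 𝓢(E, ℂ)} (hφ : HasCompactSupport φ) :
    ∃ B C, 0 < B ∧ 0 ≤ C ∧ ∀ n, P ((Δ : 𝓢(E, ℂ) → 𝓢(E, ℂ))^[n] (𝓕⁻ φ)) ≤ C * B ^ n := by
  obtain ⟨a, ha⟩ := exists_schwartz_iterate_smulLeftCLM_eq hasTemperateGrowth_laplacian_symbol hφ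
  let I : 𝓢(E, ℂ) →L[ℂ] 𝓢(E, ℂ) := FourierTransform.fourierInvCLM ℂ 𝓢(E, ℂ)
  have hPI : Continuous (P.comp I.toLinearMap) := hP.comp I.continuous
  obtain ⟨B, C, hB, hC, h⟩ := exists_seminorm_iterate_smulLeftCLM_le hPI a φ
  refine ⟨B, C, hB, hC, fun n => ?_⟩
  rw [iterate_laplacian_fourierInv, ha]
  exact h n

theorem dense_fourierInv_image_hasCompactSupport :
    Dense ((𝓕⁻ : 𝓢(E, ℂ) → 𝓢(E, ℂ)) '' {φ | HasCompactSupport φ}) :=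
  have hsurj : Function.Surjective (𝓕⁻ : 𝓢(E, ℂ) → 𝓢(E, ℂ)) := fun φ =>
    ⟨𝓕 φ, FourierTransform.fourierInv_fourier_eq φ⟩
  hsurj.denseRange.dense_image (FourierTransform.fourierInvCLM ℂ 𝓢(E, ℂ)).continuous
    dense_setOf_hasCompactSupport_schwartz

namespace IsDistributionalWaveSolution

omit [MeasurableSpace E] [BorelSpace E] in
theorem continuousOn {p : ℝ → 𝓢'(E, ℂ)} {f : 𝓢'(E, ℂ)} (hp : IsDistributionalWaveSolution p f)
    (φ : 𝓢(E, ℂ)) : ContinuousOn (fun t => p t φ) (Set.Ici 0) := fun t ht => by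
  rcases eq_or_lt_of_le (Set.mem_Ici.1 ht) with rfl | ht
  · exact (hp.initial_velocity φ).continuousWithinAt
  · exact (hp.differentiable φ t ht).continuousAt.continuousWithinAt

omit [MeasurableSpace E] [BorelSpace E] in
theorem sub {p q : ℝ → 𝓢'(E, ℂ)} {f g : 𝓢'(E, ℂ)} (hp : IsDistributionalWaveSolution p f)
    (hq : IsDistributionalWaveSolution q g) :
    IsDistributionalWaveSolution (fun t => p t - q t) (f - g) where
  initial_value := by rw [hp.initial_value, hq.initial_value]
  initial_velocity φ := by
    have h := (hp.initial_velocity φ).sub (hq.initial_velocity φ)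
    rwa [sub_zero] at h
  differentiable φ t ht := (hp.differentiable φ t ht).sub (hq.differentiable φ t ht)
  wave φ t ht := by
    have hderiv : (deriv fun s => (p s - q s) φ) =ᶠ[𝓝 t]
        deriv (fun s => p s φ) - deriv (fun s => q s φ) := by
      filter_upwards [lt_mem_nhds ht] with s hs
      exact deriv_sub (hp.differentiable φ s hs) (hq.differentiable φ s hs)
    refine HasDerivAt.congr_of_eventuallyEq ?_ hderiv
    convert! (hp.wave φ t ht).sub (hq.wave φ t ht) using 1
    simp only [TemperedDistribution.laplacian_apply_apply]
    rfl

theorem eq_zero {d : ℝ → 𝓢'(E, ℂ)} (hd : IsDistributionalWaveSolution d 0) {T : ℝ} (hT : 0 ≤ T) :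
    d T = 0 := by
  rcases hT.eq_or_lt with rfl | hT
  · exact hd.initial_value
  have hbdd : ∀ φ, BddAbove (Set.range fun t : Set.Icc 0 T => ‖d t φ‖) := fun φ => by
    have h := isCompact_Icc.bddAbove_image
      ((hd.continuousOn φ).mono (Set.Icc_subset_Ici_self (a := T) (b := 0))).norm
    rwa [Set.image_eq_range] at h
  obtain ⟨P, hP, hdP⟩ := exists_continuous_seminorm_of_pointwise_bounded hbdd
  suffices h : ∀ η : 𝓢(E, ℂ), HasCompactSupport η → d T (𝓕⁻ η) = 0 by
    refine DFunLike.coe_injective (Continuous.ext_on dense_fourierInv_image_hasCompactSupport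
      (d T).continuous (0 : 𝓢'(E, ℂ)).continuous ?_)
    rintro _ ⟨η, hη, rfl⟩
    exact h η hη
  intro η hη
  obtain ⟨B, C, hB, hC, hPB⟩ := exists_seminorm_iterate_laplacian_fourierInv_le hP hη
  refine eq_zero_of_deriv_deriv_eq_succ_of_norm_le_pow
    (y := fun n t => d t ((Δ : 𝓢(E, ℂ) → 𝓢(E, ℂ))^[n] (𝓕⁻ η)))
    (fun n => by rw [hd.initial_value]; rfl) (fun n => hd.initial_velocity _)
    (fun n => hd.differentiable _) (fun n t ht => ?_) hB hC
    (fun n t ht => (hdP ⟨t, ht.1.le, ht.2⟩ _).trans (hPB n)) 0 T ⟨hT, le_rfl⟩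
  rw [Function.iterate_succ_apply', ← TemperedDistribution.laplacian_apply_apply]
  exact hd.wave _ t ht

protected theorem unique {p q : ℝ → 𝓢'(E, ℂ)} {f : 𝓢'(E, ℂ)}
    (hp : IsDistributionalWaveSolution p f) (hq : IsDistributionalWaveSolution q f) {t : ℝ}
    (ht : 0 ≤ t) : p t = q t :=
  sub_eq_zero.1 ((sub_self f ▸ hp.sub hq).eq_zero ht)

end IsDistributionalWaveSolution

end Uniqueness

/-! ### Waves given by their Fourier transform -/

section CosineWave

open MeasureTheory
open scoped FourierTransform Laplacian ENNReal

theorem hasDerivAt_integral_comp_mul_smul {X G : Type*} [MeasurableSpace X] {μ : Measure X}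
    [NormedAddCommGroup G] [NormedSpace ℝ G] {c c' : ℝ → ℝ} {M : ℝ}
    (hc : ∀ s, HasDerivAt c (c' s) s) (hc' : Continuous c') (hM : ∀ s, ‖c s‖ ≤ M)
    (hM' : ∀ s, ‖c' s‖ ≤ M) {a : X → ℝ} (ha : AEStronglyMeasurable a μ) {h : X → G}
    (hh : Integrable h μ) (hah : Integrable (fun x => a x • h x) μ) (t : ℝ) :
    HasDerivAt (fun t => ∫ x, c (t * a x) • h x ∂μ) (∫ x, c' (t * a x) • a x • h x ∂μ) t := by
  have hcont : Continuous c := continuous_iff_continuousAt.2 fun s => (hc s).continuousAt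
  refine (hasDerivAt_integral_of_dominated_loc_of_deriv_le (s := Set.univ)
    (F' := fun s x => c' (s * a x) • a x • h x) (bound := fun x => M * ‖a x • h x‖) univ_mem
    (.of_forall fun s => (hcont.comp_aestronglyMeasurable (ha.const_mul s)).smul
      hh.aestronglyMeasurable)
    (hh.bdd_smul M (hcont.comp_aestronglyMeasurable (ha.const_mul t)) (.of_forall fun x => hM _))
    ((hc'.comp_aestronglyMeasurable (ha.const_mul t)).smul hah.aestronglyMeasurable)
    (.of_forall fun x s _ => ?_) (hah.norm.const_mul M) (.of_forall fun x s _ => ?_)).2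
  · rw [norm_smul]
    gcongr
    exact hM' _
  · rw [smul_smul]
    exact ((hc _).comp s (hasDerivAt_mul_const (a x))).smul_const (h x)

section Cosine

variable {X G : Type*} [MeasurableSpace X] {μ : Measure X} [NormedAddCommGroup G]
  [NormedSpace ℝ G] {a : X → ℝ} {h : X → G}

theorem hasDerivAt_integral_cos_mul_smul (ha : AEStronglyMeasurable a μ) (hh : Integrable h μ)
    (hah : Integrable (fun x => a x • h x) μ) (t : ℝ) :
    HasDerivAt (fun t => ∫ x, Real.cos (t * a x) • h x ∂μ)
      (∫ x, -Real.sin (t * a x) • a x • h x ∂μ) t :=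
  hasDerivAt_integral_comp_mul_smul Real.hasDerivAt_cos (by fun_prop) Real.abs_cos_le_one
    (fun s => by simpa using Real.abs_sin_le_one s) ha hh hah t

theorem hasDerivAt_deriv_integral_cos_mul_smul (ha : AEStronglyMeasurable a μ)
    (hh : Integrable h μ) (hah : Integrable (fun x => a x • h x) μ)
    (haah : Integrable (fun x => a x ^ 2 • h x) μ) (t : ℝ) :
    HasDerivAt (deriv fun t => ∫ x, Real.cos (t * a x) • h x ∂μ)
      (-∫ x, Real.cos (t * a x) • a x ^ 2 • h x ∂μ) t := by
  rw [funext fun s => (hasDerivAt_integral_cos_mul_smul ha hh hah s).deriv, ← integral_neg]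
  simp only [sq, mul_smul, ← neg_smul] at haah ⊢
  exact hasDerivAt_integral_comp_mul_smul (c := fun s => -Real.sin s) (M := 1)
    (fun s => (Real.hasDerivAt_sin s).neg) (by fun_prop)
    (fun s => by simpa using Real.abs_sin_le_one s)
    (fun s => by simpa using Real.abs_cos_le_one s) ha hah haah t

end Cosine

variable {E : Type*} [NormedAddCommGroup E] [InnerProductSpace ℝ E] [FiniteDimensional ℝ E]
  [MeasurableSpace E] [BorelSpace E]

theorem integrable_pow_norm_smul {F : Type*} [NormedAddCommGroup F] [NormedSpace ℝ F]
    (φ : 𝓢(E, F)) (n : ℕ) : Integrable fun k => (2 * Real.pi * ‖k‖) ^ n • φ k := by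
  rw [← integrable_norm_iff (by fun_prop)]
  refine ((φ.integrable_pow_mul volume n).const_mul ((2 * Real.pi) ^ n)).congr
    (.of_forall fun k => ?_)
  simp only [norm_smul, norm_pow, norm_mul, norm_norm, Real.norm_ofNat,
    Real.norm_of_nonneg Real.pi_pos.le]
  ring

theorem integrable_pow_norm_smul_mul_of_memLp_top {g : E → ℂ} (hg : MemLp g ∞) (φ : 𝓢(E, ℂ))
    (n : ℕ) : Integrable fun k => (2 * Real.pi * ‖k‖) ^ n • (φ k * g k) :=
  ((integrable_pow_norm_smul φ n).mul_of_top_left hg).congr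
    (.of_forall fun _ => smul_mul_assoc _ _ _)

theorem memLp_top_cos_smul {g : E → ℂ} (hg : MemLp g ∞) (t : ℝ) :
    MemLp (fun k => Real.cos (t * (2 * Real.pi * ‖k‖)) • g k) ∞ :=
  have hcos : MemLp (fun k : E => Real.cos (t * (2 * Real.pi * ‖k‖))) ∞ :=
    memLp_top_of_bound (by fun_prop) 1 (.of_forall fun k => Real.abs_cos_le_one _)
  hg.smul hcos

/-- The wave whose initial value is the Fourier transform of the bounded function `g` and which
starts at rest: each frequency `k` evolves by the factor `cos (2π ‖k‖ t)`. -/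
def cosineWave {g : E → ℂ} (hg : MemLp g ∞) (t : ℝ) : 𝓢'(E, ℂ) :=
  𝓕 (Lp.toTemperedDistribution ((memLp_top_cos_smul hg t).toLp _))

theorem cosineWave_apply {g : E → ℂ} (hg : MemLp g ∞) (t : ℝ) (φ : 𝓢(E, ℂ)) :
    cosineWave hg t φ = ∫ k, Real.cos (t * (2 * Real.pi * ‖k‖)) • (𝓕 φ k * g k) := by
  rw [cosineWave, TemperedDistribution.fourier_apply, Lp.toTemperedDistribution_apply]
  refine integral_congr_ae ?_
  filter_upwards [(memLp_top_cos_smul hg t).coeFn_toLp] with k hk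
  rw [hk, smul_eq_mul, mul_smul_comm]

theorem fourier_laplacian_apply (φ : 𝓢(E, ℂ)) (k : E) :
    𝓕 (Δ φ) k = -((2 * Real.pi * ‖k‖) ^ 2 • 𝓕 φ k) := by
  conv_lhs => rw [← FourierTransform.fourierInv_fourier_eq (F := 𝓢(E, ℂ)) φ, laplacian_fourierInv,
    FourierTransform.fourier_fourierInv_eq]
  rw [SchwartzMap.smulLeftCLM_apply_apply hasTemperateGrowth_laplacian_symbol, neg_mul, neg_smul,
    ← mul_pow]

theorem isDistributionalWaveSolution_cosineWave {g : E → ℂ} (hg : MemLp g ∞) {f : 𝓢'(E, ℂ)}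
    (hf : ∀ φ, f φ = ∫ k, 𝓕 φ k * g k) : IsDistributionalWaveSolution (cosineWave hg) f := by
  have hmeas : AEStronglyMeasurable (fun k : E => 2 * Real.pi * ‖k‖) := by fun_prop
  have hint := fun φ : 𝓢(E, ℂ) => integrable_pow_norm_smul_mul_of_memLp_top hg (𝓕 φ)
  have hfirst (φ : 𝓢(E, ℂ)) (t : ℝ) := hasDerivAt_integral_cos_mul_smul hmeas
    (by simpa using hint φ 0) (by simpa using hint φ 1) t
  have hsecond (φ : 𝓢(E, ℂ)) (t : ℝ) := hasDerivAt_deriv_integral_cos_mul_smul hmeas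
    (by simpa using hint φ 0) (by simpa using hint φ 1) (hint φ 2) t
  simp only [← cosineWave_apply hg] at hfirst hsecond
  refine ⟨?_, fun φ => ?_, fun φ t _ => (hfirst φ t).differentiableAt, fun φ t _ => ?_⟩
  · ext φ
    simp only [cosineWave_apply, hf, zero_mul, Real.cos_zero, one_smul]
  · simpa using (hfirst φ 0).hasDerivWithinAt
  · convert! hsecond φ t using 1
    rw [TemperedDistribution.laplacian_apply_apply, cosineWave_apply, ← integral_neg]
    refine integral_congr_ae (.of_forall fun k => ?_)
    simp only [fourier_laplacian_apply, neg_mul, smul_neg, smul_mul_assoc]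

end CosineWave

section StandingWave

open MeasureTheory
open scoped FourierTransform Laplacian RealInnerProductSpace

variable {E : Type*} [NormedAddCommGroup E] [InnerProductSpace ℝ E] [FiniteDimensional ℝ E]
  [MeasurableSpace E] [BorelSpace E]

omit [MeasurableSpace E] [BorelSpace E] in
theorem IsClassicalWaveSolution.congr {u v : E → ℝ → ℝ} {f : E → ℝ}
    (hu : IsClassicalWaveSolution u f) (huv : ∀ x t, 0 ≤ t → v x t = u x t) :
    IsClassicalWaveSolution v f where
  smooth := hu.smooth.congr fun q hq => huv q.1 q.2 hq.2
  wave x t ht := by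
    have htime : (fun s => v x s) =ᶠ[𝓝 t] fun s => u x s :=
      (eventually_ge_nhds ht).mono fun s hs => huv x s hs
    rw [htime.iteratedDeriv_eq, hu.wave x t ht, funext fun y => huv y t ht.le]
  initial_value x := (huv x 0 le_rfl).trans (hu.initial_value x)
  initial_velocity x :=
    (hu.initial_velocity x).congr (fun s hs => huv x s hs) (huv x 0 le_rfl)

theorem laplacian_fourier {G : Type*} [NormedAddCommGroup G] [NormedSpace ℂ G] {h : E → G}
    (hm : AEStronglyMeasurable h) (hh : ∀ n ≤ 2, Integrable fun k => ‖k‖ ^ n * ‖h k‖) (x : E) :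
    Δ (𝓕 h) x = -𝓕 (fun k => (2 * Real.pi * ‖k‖) ^ 2 • h k) x := by
  have hint := (VectorFourier.integrable_fourierPowSMulRight (innerSL ℝ) (hh 2 le_rfl) hm)
  have hderiv (e : E) : iteratedFDeriv ℝ 2 (𝓕 h) x ![e, e]
      = 𝓕 (fun k => VectorFourier.fourierPowSMulRight (innerSL ℝ) h k 2 ![e, e]) x := by
    rw [Real.iteratedFDeriv_fourier (N := 2) (fun n hn => hh n (by exact_mod_cast hn)) hm le_rfl,
      Real.fourier_continuousMultilinearMap_apply hint]
  simp only [InnerProductSpace.laplacian_eq_iteratedFDeriv_stdOrthonormalBasis, hderiv]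
  simp only [Real.fourier_eq]
  rw [← integral_finsetSum, ← integral_neg]
  · refine integral_congr_ae (.of_forall fun k => ?_)
    simp only [← Finset.smul_sum, ← smul_neg]
    congr 1
    simp only [VectorFourier.fourierPowSMulRight_apply, Fin.prod_univ_two, Matrix.cons_val_zero,
      Matrix.cons_val_one, ← sq, ← Finset.smul_sum, ← Finset.sum_smul]
    change (-(2 * Real.pi * Complex.I)) ^ 2 •
      (∑ i, ⟪k, stdOrthonormalBasis ℝ E i⟫ ^ 2) • h k = _
    rw [(stdOrthonormalBasis ℝ E).sum_sq_inner_left, ← Complex.coe_smul, ← Complex.coe_smul,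
      smul_smul, smul_neg, ← neg_smul]
    congr 1
    push_cast
    linear_combination (2 * Real.pi * ‖k‖ : ℂ) ^ 2 * Complex.I_sq
  · exact fun i _ => (Real.fourierIntegral_convergent_iff x).2
      ((ContinuousMultilinearMap.apply ℝ _ _ _).integrable_comp hint)

theorem contDiff_integral_fourierChar_inner_add_norm_mul (h : 𝓢(E, ℂ)) {n : ℕ∞} :
    ContDiff ℝ n fun q : E × ℝ => ∫ k, 𝐞 (-(⟪k, q.1⟫ + ‖k‖ * q.2)) • h k := by
  let γ : E → E × ℝ := fun k => (k, ‖k‖)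
  have hγ : Continuous γ := by fun_prop
  have hγ_emb : MeasurableEmbedding γ :=
    (Function.LeftInverse.isClosedEmbedding (f := Prod.fst) (fun _ => rfl) continuous_fst
      hγ).measurableEmbedding
  let innerBilin : E →L[ℝ] E →L[ℝ] ℝ := innerSL ℝ
  let B : E × ℝ →L[ℝ] E × ℝ →L[ℝ] ℝ :=
    innerBilin.bilinearComp (.fst ℝ E ℝ) (.fst ℝ E ℝ) +
      (ContinuousLinearMap.mul ℝ ℝ).bilinearComp (.snd ℝ E ℝ) (.snd ℝ E ℝ)
  have hsmooth := VectorFourier.contDiff_fourierIntegral (N := n) (μ := volume.map γ)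
    (f := fun w => h w.1) B fun j _ => by
      rw [hγ_emb.integrable_map_iff]
      simpa [Function.comp_def, γ, Prod.norm_def] using h.integrable_pow_mul volume j
  convert! hsmooth using 2 with q
  rw [VectorFourier.fourierIntegral, hγ_emb.integral_map]
  rfl

/-- The wave with initial value `𝓕 h` which starts at rest, as a function. -/
def standingWave (h : 𝓢(E, ℂ)) (t : ℝ) : E → ℂ :=
  𝓕 fun k => Real.cos (t * (2 * Real.pi * ‖k‖)) • h k

variable (h : 𝓢(E, ℂ))

theorem standingWave_zero : standingWave h 0 = 𝓕 h := by
  simp [standingWave, SchwartzMap.fourier_coe]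

theorem contDiff_standingWave {n : ℕ∞} :
    ContDiff ℝ n fun q : E × ℝ => standingWave h q.2 q.1 := by
  have hsplit : (fun q : E × ℝ => standingWave h q.2 q.1) = fun q =>
      (2⁻¹ : ℝ) • ((∫ k, 𝐞 (-(⟪k, q.1⟫ + ‖k‖ * q.2)) • h k) +
        ∫ k, 𝐞 (-(⟪k, q.1⟫ + ‖k‖ * -q.2)) • h k) := by
    funext q
    have hint (s : ℝ) : Integrable fun k => 𝐞 (-(⟪k, q.1⟫ + ‖k‖ * s)) • h k := by
      refine (integrable_norm_iff ?_).1 (by simpa using h.integrable.norm)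
      exact (Continuous.aestronglyMeasurable (by fun_prop))
    rw [← integral_add (hint _) (hint _), ← integral_smul, standingWave, Real.fourier_eq]
    refine integral_congr_ae (.of_forall fun k => ?_)
    simp only [neg_add, AddChar.map_add_eq_mul, mul_smul, ← smul_add]
    rw [smul_comm (2⁻¹ : ℝ)]
    congr 1
    simp only [Circle.smul_def, Real.fourierChar_apply, smul_eq_mul, ← add_mul, Complex.real_smul]
    rw [Complex.ofReal_cos, Complex.cos]
    push_cast
    ring_nf
  rw [hsplit]
  have hplus := contDiff_integral_fourierChar_inner_add_norm_mul h (n := n)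
  exact (hplus.add (hplus.comp (contDiff_fst.prodMk contDiff_snd.neg))).const_smul _

theorem continuous_standingWave : Continuous fun q : E × ℝ => standingWave h q.2 q.1 :=
  (contDiff_standingWave h (n := 0)).continuous

theorem standingWave_apply (t : ℝ) (x : E) : standingWave h t x =
    ∫ k, Real.cos (t * (2 * Real.pi * ‖k‖)) • 𝐞 (-⟪k, x⟫) • h k := by
  rw [standingWave, Real.fourier_eq]
  exact integral_congr_ae (.of_forall fun k => smul_comm _ _ _)

theorem integrable_pow_norm_smul_fourierChar_smul (n : ℕ) (x : E) :
    Integrable fun k => (2 * Real.pi * ‖k‖) ^ n • 𝐞 (-⟪k, x⟫) • h k :=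
  ((Real.fourierIntegral_convergent_iff x).2 (integrable_pow_norm_smul h n)).congr
    (.of_forall fun _ => smul_comm _ _ _)

theorem hasDerivAt_standingWave_zero (x : E) : HasDerivAt (fun t => standingWave h t x) 0 0 := by
  have hint := fun n => integrable_pow_norm_smul_fourierChar_smul h n x
  simp only [standingWave_apply]
  convert! hasDerivAt_integral_cos_mul_smul (μ := volume) (a := fun k : E => 2 * Real.pi * ‖k‖)
    (by fun_prop) (by simpa only [pow_zero, one_smul] using hint 0)
    (by simpa only [pow_one] using hint 1) 0 using 1
  simp

theorem laplacian_standingWave (t : ℝ) (x : E) : Δ (standingWave h t) x =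
    -∫ k, Real.cos (t * (2 * Real.pi * ‖k‖)) • (2 * Real.pi * ‖k‖) ^ 2 • 𝐞 (-⟪k, x⟫) • h k := by
  rw [standingWave, laplacian_fourier, Real.fourier_eq]
  · congr 1
    refine integral_congr_ae (.of_forall fun k => ?_)
    simp only [smul_comm (𝐞 _)]
    rw [smul_comm]
  · exact Continuous.aestronglyMeasurable (by fun_prop)
  · intro n _
    refine (h.integrable_pow_mul volume n).mono' ?_ (.of_forall fun k => ?_)
    · exact Continuous.aestronglyMeasurable (by fun_prop)
    simp only [norm_mul, norm_pow, norm_smul, Real.norm_eq_abs, abs_norm, abs_abs]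
    exact mul_le_mul_of_nonneg_left (mul_le_of_le_one_left (norm_nonneg (h k))
      (Real.abs_cos_le_one _)) (by positivity)

theorem iteratedDeriv_two_standingWave (t : ℝ) (x : E) :
    iteratedDeriv 2 (fun s => standingWave h s x) t = Δ (standingWave h t) x := by
  have hint := fun n => integrable_pow_norm_smul_fourierChar_smul h n x
  rw [iteratedDeriv_succ, iteratedDeriv_one, laplacian_standingWave]
  simp only [standingWave_apply]
  exact (hasDerivAt_deriv_integral_cos_mul_smul (by fun_prop) (by simpa using hint 0)
    (by simpa using hint 1) (hint 2) t).deriv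

theorem isClassicalWaveSolution_re_standingWave {f : E → ℝ} (hf : ∀ x, 𝓕 h x = f x) :
    IsClassicalWaveSolution (fun x t => (standingWave h t x).re) f where
  smooth := (Complex.reCLM.contDiff.comp (contDiff_standingWave h (n := 2))).contDiffOn
  wave x t _ := by
    have htime : ContDiffAt ℝ 2 (fun s => standingWave h s x) t :=
      ((contDiff_standingWave h (n := 2)).comp (contDiff_prodMk_right x)).contDiffAt
    have hspace : ContDiffAt ℝ 2 (standingWave h t) x :=
      ((contDiff_standingWave h (n := 2)).comp (contDiff_prodMk_left t)).contDiffAt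
    rw [← InnerProductSpace.laplacian_eq_iteratedDeriv_real]
    exact htime.laplacian_CLM_comp_left (l := Complex.reCLM) |>.trans <|
      congrArg Complex.re ((InnerProductSpace.laplacian_eq_iteratedDeriv_real _).trans
        (iteratedDeriv_two_standingWave h t x)) |>.trans
      (hspace.laplacian_CLM_comp_left (l := Complex.reCLM)).symm
  initial_value x := by rw [standingWave_zero, hf, Complex.ofReal_re]
  initial_velocity x := by
    have hre := Complex.reCLM.hasFDerivAt.comp_hasDerivAt 0 (hasDerivAt_standingWave_zero h x)
    rw [map_zero] at hre
    exact hre.hasDerivWithinAt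

open scoped ComplexConjugate in
theorem ofReal_re_standingWave {f : E → ℝ} (hf : ∀ x, 𝓕 h x = f x) (t : ℝ) (x : E) :
    ((standingWave h t x).re : ℂ) = standingWave h t x := by
  have hsymm (k : E) : conj (h k) = h (-k) := by
    rw [← FourierTransform.fourierInv_fourier_eq (F := 𝓢(E, ℂ)) h]
    simp only [SchwartzMap.fourierInv_coe, Real.fourierInv_eq, hf, ← integral_conj, Circle.smul_def,
      smul_eq_mul, map_mul, Complex.conj_ofReal, Circle.coe_inv_eq_conj, inner_neg_right,
      AddChar.map_neg_eq_inv]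
  rw [← Complex.conj_eq_iff_re, standingWave_apply, ← integral_conj, ← integral_neg_eq_self]
  refine integral_congr_ae (.of_forall fun k => ?_)
  simp only [Complex.real_smul, map_mul, Complex.conj_ofReal, norm_neg, Circle.smul_def,
    smul_eq_mul, hsymm, neg_neg, inner_neg_left, AddChar.map_neg_eq_inv,
    Circle.coe_inv_eq_conj]

end StandingWave

section PlanarSource

open MeasureTheory
open scoped FourierTransform RealInnerProductSpace ENNReal

theorem memLp_top_comp_fst (h : 𝓢(Plane, ℂ)) : MemLp (fun x : Space3 => h x.fst) ∞ := by
  have hcont : Continuous fun x : Space3 => h x.fst :=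
    h.continuous.comp (continuous_fst.comp (WithLp.prod_continuous_ofLp 2 Plane ℝ))
  exact memLp_top_of_bound hcont.aestronglyMeasurable _
    (.of_forall fun x => SchwartzMap.norm_le_seminorm ℝ h x.fst)

theorem integral_fourier_mul_fourierInv_fst (φ : 𝓢(Space3, ℂ)) (u : 𝓢(Plane, ℂ)) :
    ∫ k, (𝓕 φ : 𝓢(Space3, ℂ)) k * 𝓕⁻ u k.fst = ∫ ξ, φ (WithLp.toLp 2 (ξ, (0 : ℝ))) * u ξ := by
  let L : Plane →ₗ[ℝ] Space3 →ₗ[ℝ] ℝ := -(innerₗ Space3 ∘ₗ planeIncl.toLinearMap)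
  have hL (ξ : Plane) (k : Space3) : L ξ k = -⟪k.fst, ξ⟫ := by
    simp [L, planeIncl_apply, WithLp.prod_inner_apply, real_inner_comm]
  have hL_incl (ξ : Plane) (k : Space3) : L ξ k = -⟪k, planeIncl ξ⟫ := by
    rw [hL, planeIncl_apply, WithLp.prod_inner_apply]
    simp
  have hcont : Continuous fun q : Plane × Space3 => L q.1 q.2 := by
    simp only [hL_incl]
    fun_prop
  have hflip := VectorFourier.integral_fourierIntegral_smul_eq_flip (e := 𝐞) (μ := volume)
    (ν := volume) (L := L) Real.continuous_fourierChar hcont u.integrable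
    (𝓕 φ : 𝓢(Space3, ℂ)).integrable
  have hfst (k : Space3) : VectorFourier.fourierIntegral 𝐞 volume L u k = 𝓕⁻ u k.fst := by
    simp only [SchwartzMap.fourierInv_coe, Real.fourierInv_eq, VectorFourier.fourierIntegral, hL,
      neg_neg, real_inner_comm]
  have hincl (ξ : Plane) :
      VectorFourier.fourierIntegral 𝐞 volume L.flip (𝓕 φ : 𝓢(Space3, ℂ)) ξ = φ (planeIncl ξ) := by
    conv_rhs => rw [← FourierTransform.fourierInv_fourier_eq (F := 𝓢(Space3, ℂ)) φ]
    simp only [SchwartzMap.fourierInv_coe, Real.fourierInv_eq, VectorFourier.fourierIntegral,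
      LinearMap.flip_apply, hL_incl, neg_neg]
  simpa only [hfst, hincl, smul_eq_mul, mul_comm, planeIncl_apply] using hflip

variable {f : Plane → ℝ} (hf : ContDiff ℝ ∞ f) (hc : HasCompactSupport f)

/-- The three-dimensional wave with initial value `f(ξ) δ(z)` which starts at rest. The Fourier
transform of the initial value depends on the horizontal frequency only. -/
def planarWave : ℝ → 𝓢'(Space3, ℂ) :=
  cosineWave (memLp_top_comp_fst (𝓕⁻ (complexTest f hf hc)))

theorem isDistributionalWaveSolution_planarWave :
    IsDistributionalWaveSolution (planarWave hf hc) (planarSource f hf hc) :=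
  isDistributionalWaveSolution_cosineWave _ fun φ => by
    rw [planarSource_apply]
    exact (integral_fourier_mul_fourierInv_fst φ (complexTest f hf hc)).symm

end PlanarSource

/-! ### The vertical integral -/

section ApproximateUnit

open MeasureTheory
open scoped FourierTransform Laplacian

theorem norm_iteratedDeriv_inv_one_add_sq_le {j : ℕ} (hj : j ≤ 2) (κ : ℝ) :
    ‖iteratedDeriv j (fun κ : ℝ => (1 + κ ^ 2)⁻¹) κ‖ ≤ 10 * (1 + κ ^ 2)⁻¹ := by
  set b : ℝ → ℝ := fun κ => (1 + κ ^ 2)⁻¹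
  have hpos (κ : ℝ) : 0 < 1 + κ ^ 2 := by positivity
  have hb (κ : ℝ) : HasDerivAt b (-(2 * κ) * b κ ^ 2) κ := by
    convert! ((hasDerivAt_pow 2 κ).const_add 1).inv (hpos κ).ne' using 1
    simp [b, div_eq_mul_inv]
  have hb' (κ : ℝ) : HasDerivAt (fun κ => -(2 * κ) * b κ ^ 2)
      (b κ * (-2 * b κ + 8 * (κ ^ 2 * b κ) * b κ)) κ := by
    convert! ((hasDerivAt_id κ).const_mul 2).neg.mul ((hb κ).pow 2) using 1
    simp
    ring
  have hb_pos : 0 < b κ := inv_pos.2 (hpos κ)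
  have hb_le : b κ ≤ 1 := inv_le_one_of_one_le₀ (by nlinarith [sq_nonneg κ])
  have hsq : b κ + κ ^ 2 * b κ = 1 := by
    rw [← one_add_mul]
    exact mul_inv_cancel₀ (hpos κ).ne'
  have hsq_nonneg : 0 ≤ κ ^ 2 * b κ := by positivity
  interval_cases j
  · rw [iteratedDeriv_zero, Real.norm_of_nonneg hb_pos.le]
    linarith [hsq_nonneg]
  · rw [iteratedDeriv_one, (hb κ).deriv, Real.norm_eq_abs, abs_le]
    constructor <;> nlinarith [sq_nonneg (κ + 1), sq_nonneg (κ - 1)]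
  · rw [iteratedDeriv_succ, iteratedDeriv_one, funext fun κ => (hb κ).deriv, (hb' κ).deriv,
      norm_mul, Real.norm_of_nonneg hb_pos.le, mul_comm 10]
    gcongr
    rw [Real.norm_eq_abs, abs_le]
    constructor <;> nlinarith

theorem contDiff_inv_one_add_sq {n : ℕ∞} : ContDiff ℝ n fun κ : ℝ => (1 + κ ^ 2)⁻¹ := by
  fun_prop (disch := intro; positivity)

/-- The integrable function `m(κ) / (1 + κ²)`. Pairing a bounded `m` with `𝓕 χ` amounts to pairing
its damped version with `(1 + κ²) 𝓕 χ`, the Fourier transform of `χ - (2π)⁻² χ''`. -/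
def dampedSymbol (m : ℝ → ℂ) (κ : ℝ) : ℂ := (1 + κ ^ 2)⁻¹ • m κ

theorem contDiff_dampedSymbol {m : ℝ → ℂ} {n : ℕ∞} (hm : ContDiff ℝ n m) :
    ContDiff ℝ n (dampedSymbol m) :=
  contDiff_inv_one_add_sq.smul hm

variable {m : ℝ → ℂ} {M : ℝ}

theorem norm_iteratedDeriv_dampedSymbol_le (hm : ContDiff ℝ 2 m)
    (hM : ∀ j ≤ 2, ∀ κ, ‖iteratedDeriv j m κ‖ ≤ M) {j : ℕ} (hj : j ≤ 2) (κ : ℝ) :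
    ‖iteratedDeriv j (dampedSymbol m) κ‖ ≤ 40 * M * (1 + κ ^ 2)⁻¹ := by
  have hM₀ : 0 ≤ M := (norm_nonneg _).trans (hM 0 zero_le_two 0)
  calc ‖iteratedDeriv j (dampedSymbol m) κ‖
    _ ≤ ∑ i ∈ Finset.range (j + 1), (j.choose i : ℝ) *
        ‖iteratedDeriv i (fun κ : ℝ => (1 + κ ^ 2)⁻¹) κ‖ * ‖iteratedDeriv (j - i) m κ‖ := by
      simp only [← norm_iteratedFDeriv_eq_norm_iteratedDeriv]
      exact norm_iteratedFDeriv_smul_le (contDiff_inv_one_add_sq (n := 2)) hm κ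
        (by exact_mod_cast hj)
    _ ≤ ∑ i ∈ Finset.range (j + 1), (j.choose i : ℝ) * (10 * (1 + κ ^ 2)⁻¹) * M := by
      refine Finset.sum_le_sum fun i hi => ?_
      have hij : i ≤ j := Finset.mem_range_succ_iff.1 hi
      gcongr
      · exact norm_iteratedDeriv_inv_one_add_sq_le (hij.trans hj) κ
      · exact hM _ ((j.sub_le i).trans hj) κ
    _ = 2 ^ j * (10 * (1 + κ ^ 2)⁻¹ * M) := by
      simp only [mul_assoc, ← Finset.sum_mul]
      rw [← Nat.cast_sum, Nat.sum_range_choose]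
      norm_num
    _ ≤ 2 ^ 2 * (10 * (1 + κ ^ 2)⁻¹ * M) := by gcongr; norm_num
    _ = 40 * M * (1 + κ ^ 2)⁻¹ := by ring

theorem integrable_iteratedDeriv_dampedSymbol (hm : ContDiff ℝ 2 m)
    (hM : ∀ j ≤ 2, ∀ κ, ‖iteratedDeriv j m κ‖ ≤ M) {j : ℕ} (hj : j ≤ 2) :
    Integrable (iteratedDeriv j (dampedSymbol m)) :=
  (integrable_inv_one_add_sq.const_mul (40 * M)).mono'
    ((contDiff_dampedSymbol (n := 2) hm).continuous_iteratedDeriv j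
      (by exact_mod_cast hj)).aestronglyMeasurable
    (.of_forall (norm_iteratedDeriv_dampedSymbol_le hm hM hj))

theorem norm_fourier_dampedSymbol_le (hm : ContDiff ℝ 2 m)
    (hM : ∀ j ≤ 2, ∀ κ, ‖iteratedDeriv j m κ‖ ≤ M) (x : ℝ) :
    ‖𝓕 (dampedSymbol m) x‖ ≤ 80 * Real.pi * M * (1 + (2 * Real.pi * x) ^ 2)⁻¹ := by
  have hint := fun j (hj : j ≤ 2) => integrable_iteratedDeriv_dampedSymbol hm hM hj
  have hbound {j : ℕ} (hj : j ≤ 2) :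
      ‖𝓕 (iteratedDeriv j (dampedSymbol m)) x‖ ≤ 40 * Real.pi * M :=
    calc ‖𝓕 (iteratedDeriv j (dampedSymbol m)) x‖
      _ ≤ ∫ κ, ‖iteratedDeriv j (dampedSymbol m) κ‖ := by
        rw [Real.fourier_eq]
        exact (norm_integral_le_integral_norm _).trans_eq (by simp only [Circle.norm_smul])
      _ ≤ ∫ κ, 40 * M * (1 + κ ^ 2)⁻¹ :=
        integral_mono (hint j hj).norm (integrable_inv_one_add_sq.const_mul _)
          (norm_iteratedDeriv_dampedSymbol_le hm hM hj)
      _ = 40 * Real.pi * M := by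
        rw [integral_const_mul, integral_univ_inv_one_add_sq]
        ring
  have hsecond : ‖𝓕 (iteratedDeriv 2 (dampedSymbol m)) x‖
      = (2 * Real.pi * x) ^ 2 * ‖𝓕 (dampedSymbol m) x‖ := by
    rw [Real.fourier_iteratedDeriv (N := 2) (contDiff_dampedSymbol hm)
      (fun j hj => hint j (by exact_mod_cast hj)) le_rfl]
    simp only [norm_smul, norm_pow, norm_mul, Complex.norm_I, Complex.norm_real, Complex.norm_ofNat,
      Real.norm_eq_abs, mul_pow, sq_abs, one_pow, mul_one]
  have hzero := hbound zero_le_two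
  have htwo := hbound le_rfl
  rw [iteratedDeriv_zero] at hzero
  rw [← div_eq_mul_inv, le_div_iff₀ (by positivity)]
  linarith

theorem integrable_inv_one_add_two_pi_mul_sq :
    Integrable fun x : ℝ => (1 + (2 * Real.pi * x) ^ 2)⁻¹ :=
  integrable_inv_one_add_sq.comp_mul_left' Real.two_pi_pos.ne'

theorem integrable_fourier_dampedSymbol (hm : ContDiff ℝ 2 m)
    (hM : ∀ j ≤ 2, ∀ κ, ‖iteratedDeriv j m κ‖ ≤ M) : Integrable (𝓕 (dampedSymbol m)) := by
  have hint : Integrable (dampedSymbol m) := by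
    simpa using integrable_iteratedDeriv_dampedSymbol hm hM zero_le_two
  exact (integrable_inv_one_add_two_pi_mul_sq.const_mul _).mono'
    (VectorFourier.fourierIntegral_continuous (L := innerₗ ℝ) Real.continuous_fourierChar
      continuous_inner hint).aestronglyMeasurable
    (.of_forall (norm_fourier_dampedSymbol_le hm hM))

theorem integral_fourier_dampedSymbol (hm : ContDiff ℝ 2 m)
    (hM : ∀ j ≤ 2, ∀ κ, ‖iteratedDeriv j m κ‖ ≤ M) : ∫ x, 𝓕 (dampedSymbol m) x = m 0 := by
  have hint : Integrable (dampedSymbol m) := by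
    simpa using integrable_iteratedDeriv_dampedSymbol hm hM zero_le_two
  have hinv := congrFun ((contDiff_dampedSymbol (n := 2) hm).continuous.fourierInv_fourier_eq hint
    (integrable_fourier_dampedSymbol hm hM)) 0
  simpa [Real.fourierInv_eq, dampedSymbol] using hinv

theorem integral_mul_fourier_eq (hm : ContDiff ℝ 2 m)
    (hM : ∀ j ≤ 2, ∀ κ, ‖iteratedDeriv j m κ‖ ≤ M) (χ : 𝓢(ℝ, ℂ)) :
    ∫ κ, m κ * 𝓕 χ κ =
      ∫ x, 𝓕 (dampedSymbol m) x * (χ x - (2 * Real.pi)⁻¹ ^ 2 • iteratedDeriv 2 χ x) := by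
  have hint : Integrable (dampedSymbol m) := by
    simpa using integrable_iteratedDeriv_dampedSymbol hm hM zero_le_two
  have hflip := VectorFourier.integral_fourierIntegral_smul_eq_flip (e := 𝐞) (μ := volume)
    (ν := volume) (L := innerₗ ℝ) Real.continuous_fourierChar continuous_inner hint
    (χ - (2 * Real.pi)⁻¹ ^ 2 • Δ χ).integrable
  have hχ (κ : ℝ) : 𝓕 (χ - (2 * Real.pi)⁻¹ ^ 2 • Δ χ) κ = (1 + κ ^ 2) • 𝓕 χ κ := by
    have hπ : (2 * Real.pi)⁻¹ ^ 2 * (2 * Real.pi) ^ 2 = 1 := by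
      rw [← mul_pow, inv_mul_cancel₀ Real.two_pi_pos.ne', one_pow]
    rw [sub_eq_add_neg, FourierTransform.fourier_add, FourierTransform.fourier_neg,
      FourierTransform.fourier_smul, add_apply, neg_apply, smul_apply, fourier_laplacian_apply,
      smul_neg, neg_neg, smul_smul, mul_pow, ← mul_assoc, hπ, one_mul, Real.norm_eq_abs, sq_abs,
      add_smul, one_smul]
  simp only [flip_innerₗ] at hflip
  calc ∫ κ, m κ * 𝓕 χ κ
    _ = ∫ κ, dampedSymbol m κ • 𝓕 (χ - (2 * Real.pi)⁻¹ ^ 2 • Δ χ) κ := by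
      refine integral_congr_ae (.of_forall fun κ => ?_)
      simp only [hχ, dampedSymbol, smul_eq_mul, smul_mul_smul_comm]
      rw [inv_mul_cancel₀ (by positivity : (0 : ℝ) < 1 + κ ^ 2).ne', one_smul]
    _ = ∫ x, 𝓕 (dampedSymbol m) x • (χ - (2 * Real.pi)⁻¹ ^ 2 • Δ χ) x := hflip.symm
    _ = _ := by
      simp only [sub_apply, smul_apply, SchwartzMap.laplacian_apply,
        InnerProductSpace.laplacian_eq_iteratedDeriv_real, smul_eq_mul]

section

variable {χ : ℕ → 𝓢(ℝ, ℂ)}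

theorem IsApproximateUnit.eventually_iteratedDeriv_eq_zero (hχ : IsApproximateUnit χ) {k : ℕ}
    (hk : k ≠ 0) (x : ℝ) : ∀ᶠ n in atTop, iteratedDeriv k (χ n) x = 0 := by
  filter_upwards [hχ.eventually_one (|x| + 1)] with n hn
  have hone : χ n =ᶠ[𝓝 x] fun _ => 1 := by
    filter_upwards [Metric.ball_mem_nhds x one_pos] with y hy
    rw [Metric.mem_ball, Real.dist_eq] at hy
    exact hn y (by linarith [abs_sub_abs_le_abs_sub y x])
  rw [hone.iteratedDeriv_eq, iteratedDeriv_const, if_neg hk]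

theorem IsApproximateUnit.tendsto_sub_iteratedDeriv_two (hχ : IsApproximateUnit χ) (c x : ℝ) :
    Tendsto (fun n => χ n x - c • iteratedDeriv 2 (χ n) x) atTop (𝓝 1) := by
  refine tendsto_const_nhds.congr' ?_
  filter_upwards [hχ.eventually_one |x|, hχ.eventually_iteratedDeriv_eq_zero two_ne_zero x]
    with n hone hzero
  rw [hone x le_rfl, hzero, smul_zero, sub_zero]

theorem IsApproximateUnit.exists_norm_sub_iteratedDeriv_two_le (hχ : IsApproximateUnit χ) (c : ℝ) :
    ∃ C, ∀ n x, ‖χ n x - c • iteratedDeriv 2 (χ n) x‖ ≤ C := by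
  obtain ⟨C₀, hC₀⟩ := hχ.bounded 0
  obtain ⟨C₂, hC₂⟩ := hχ.bounded 2
  refine ⟨C₀ + ‖c‖ * C₂, fun n x => (norm_sub_le _ _).trans ?_⟩
  rw [norm_smul]
  gcongr
  · simpa only [iteratedDeriv_zero] using hC₀ n x
  · exact hC₂ n x

theorem IsApproximateUnit.tendsto_integral_mul_fourier (hχ : IsApproximateUnit χ)
    (hm : ContDiff ℝ 2 m) (hM : ∀ j ≤ 2, ∀ κ, ‖iteratedDeriv j m κ‖ ≤ M) :
    Tendsto (fun n => ∫ κ, m κ * 𝓕 (χ n) κ) atTop (𝓝 (m 0)) := by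
  obtain ⟨C, hC⟩ := hχ.exists_norm_sub_iteratedDeriv_two_le ((2 * Real.pi)⁻¹ ^ 2)
  have hint := integrable_fourier_dampedSymbol hm hM
  simp only [integral_mul_fourier_eq hm hM]
  rw [← integral_fourier_dampedSymbol hm hM]
  refine tendsto_integral_of_dominated_convergence (fun x => ‖𝓕 (dampedSymbol m) x‖ * C)
    (fun n => hint.1.mul ?_) (hint.norm.mul_const C) (fun n => .of_forall fun x => ?_)
    (.of_forall fun x => ?_)
  · have hsecond := ((χ n).smooth 2).continuous_iteratedDeriv 2 le_rfl
    exact ((χ n).continuous.sub (hsecond.const_smul ((2 * Real.pi)⁻¹ ^ 2))).aestronglyMeasurable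
  · rw [norm_mul]
    gcongr
    exact hC n x
  · simpa only [mul_one] using (hχ.tendsto_sub_iteratedDeriv_two _ x).const_mul _

theorem IsApproximateUnit.exists_norm_integral_mul_fourier_le (hχ : IsApproximateUnit χ) :
    ∃ C, ∀ (m : ℝ → ℂ) (M : ℝ), ContDiff ℝ 2 m → (∀ j ≤ 2, ∀ κ, ‖iteratedDeriv j m κ‖ ≤ M) →
      ∀ n, ‖∫ κ, m κ * 𝓕 (χ n) κ‖ ≤ C * M := by
  obtain ⟨C, hC⟩ := hχ.exists_norm_sub_iteratedDeriv_two_le ((2 * Real.pi)⁻¹ ^ 2)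
  refine ⟨80 * Real.pi * C * ∫ x : ℝ, (1 + (2 * Real.pi * x) ^ 2)⁻¹, fun m M hm hM n => ?_⟩
  rw [integral_mul_fourier_eq hm hM]
  calc _ ≤ ∫ x : ℝ, 80 * Real.pi * M * (1 + (2 * Real.pi * x) ^ 2)⁻¹ * C := by
        refine norm_integral_le_of_norm_le
          ((integrable_inv_one_add_two_pi_mul_sq.const_mul _).mul_const C)
          (.of_forall fun x => ?_)
        rw [norm_mul]
        have hsymbol := norm_fourier_dampedSymbol_le hm hM x
        gcongr
        exacts [(norm_nonneg _).trans hsymbol, hC n x]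
    _ = _ := by
        rw [integral_mul_const, integral_const_mul]
        ring

end

end ApproximateUnit

section VerticalSymbol

variable {a : ℝ}

theorem contDiff_cos_mul_sqrt_sq_add_sq (ha : a ≠ 0) (τ : ℝ) {n : ℕ∞} :
    ContDiff ℝ n fun κ : ℝ => Real.cos (τ * √(a ^ 2 + κ ^ 2)) := by
  fun_prop (disch := intro; positivity)

theorem hasDerivAt_sqrt_sq_add_sq (ha : a ≠ 0) (κ : ℝ) :
    HasDerivAt (fun κ : ℝ => √(a ^ 2 + κ ^ 2)) (κ / √(a ^ 2 + κ ^ 2)) κ := by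
  convert! ((hasDerivAt_pow 2 κ).const_add (a ^ 2)).sqrt (by positivity) using 1
  field_simp
  norm_num [mul_comm]

theorem hasDerivAt_div_sqrt_sq_add_sq (ha : a ≠ 0) (κ : ℝ) :
    HasDerivAt (fun κ : ℝ => κ / √(a ^ 2 + κ ^ 2))
      ((1 - (κ / √(a ^ 2 + κ ^ 2)) ^ 2) / √(a ^ 2 + κ ^ 2)) κ := by
  have hpos : 0 < √(a ^ 2 + κ ^ 2) := Real.sqrt_pos.2 (by positivity)
  convert! (hasDerivAt_id κ).fun_div (hasDerivAt_sqrt_sq_add_sq ha κ) hpos.ne' using 1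
  simp only [id_eq]
  field_simp

theorem div_sqrt_sq_add_sq_sq_le_one (a κ : ℝ) : (κ / √(a ^ 2 + κ ^ 2)) ^ 2 ≤ 1 := by
  rw [div_pow, Real.sq_sqrt (by positivity)]
  exact div_le_one_of_le₀ (by nlinarith [sq_nonneg a]) (by positivity)

theorem abs_mul_sin_mul_div_le {s : ℝ} (hs : 0 < s) (τ : ℝ) :
    |τ * (Real.sin (τ * s) / s)| ≤ τ ^ 2 := by
  rw [← sq_abs τ, sq, abs_mul, abs_div, abs_of_pos hs]
  gcongr
  rw [div_le_iff₀ hs]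
  simpa only [abs_mul, abs_of_pos hs] using Real.abs_sin_le_abs (x := τ * s)

theorem abs_iteratedDeriv_cos_mul_sqrt_sq_add_sq_le (ha : a ≠ 0) (τ : ℝ) {j : ℕ} (hj : j ≤ 2)
    (κ : ℝ) :
    |iteratedDeriv j (fun κ : ℝ => Real.cos (τ * √(a ^ 2 + κ ^ 2))) κ| ≤ 1 + τ ^ 2 := by
  set s : ℝ → ℝ := fun κ => √(a ^ 2 + κ ^ 2)
  have hpos : 0 < s κ := Real.sqrt_pos.2 (by positivity)
  have hq : (κ / s κ) ^ 2 ≤ 1 := div_sqrt_sq_add_sq_sq_le_one a κ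
  have hfirst (κ : ℝ) : HasDerivAt (fun κ => Real.cos (τ * s κ))
      (-Real.sin (τ * s κ) * (τ * (κ / s κ))) κ :=
    ((hasDerivAt_sqrt_sq_add_sq ha κ).const_mul τ).cos
  have hsecond : HasDerivAt (fun κ => -Real.sin (τ * s κ) * (τ * (κ / s κ)))
      (-(τ ^ 2 * Real.cos (τ * s κ) * (κ / s κ) ^ 2
        + τ * (Real.sin (τ * s κ) / s κ) * (1 - (κ / s κ) ^ 2))) κ := by
    convert! ((hasDerivAt_sqrt_sq_add_sq ha κ).const_mul τ).sin.fun_neg.fun_mul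
      ((hasDerivAt_div_sqrt_sq_add_sq ha κ).const_mul τ) using 1
    ring
  interval_cases j
  · rw [iteratedDeriv_zero]
    exact (Real.abs_cos_le_one _).trans (by nlinarith [sq_nonneg τ])
  · rw [iteratedDeriv_one, (hfirst κ).deriv, abs_mul, abs_neg, abs_mul]
    calc |Real.sin (τ * s κ)| * (|τ| * |κ / s κ|)
      _ ≤ 1 * (|τ| * 1) := by
        gcongr
        exacts [Real.abs_sin_le_one _, (sq_le_one_iff_abs_le_one _).1 hq]
      _ ≤ 1 + τ ^ 2 := by nlinarith [sq_abs τ, sq_nonneg (|τ| - 1)]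
  · rw [iteratedDeriv_succ, iteratedDeriv_one, funext fun κ => (hfirst κ).deriv, hsecond.deriv,
      abs_neg]
    calc |τ ^ 2 * Real.cos (τ * s κ) * (κ / s κ) ^ 2
          + τ * (Real.sin (τ * s κ) / s κ) * (1 - (κ / s κ) ^ 2)|
      _ ≤ τ ^ 2 * 1 * (κ / s κ) ^ 2 + τ ^ 2 * (1 - (κ / s κ) ^ 2) := by
        have hsin := abs_mul_sin_mul_div_le hpos τ
        have hcompl := sub_nonneg.2 hq
        refine (abs_add_le _ _).trans ?_
        rw [abs_mul, abs_mul, abs_mul _ (1 - _), abs_of_nonneg (sq_nonneg τ),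
          abs_of_nonneg (sq_nonneg (κ / s κ)), abs_of_nonneg hcompl]
        gcongr
        exact Real.abs_cos_le_one _
      _ ≤ 1 + τ ^ 2 := by linarith

/-- `κ ↦ cos(2πt√(a² + κ²))`, the symbol of the half-wave multiplier on the vertical line of
frequencies above a point at distance `a` from the origin. -/
def verticalSymbol (t a κ : ℝ) : ℂ := Real.cos (t * (2 * Real.pi * √(a ^ 2 + κ ^ 2)))

theorem verticalSymbol_zero (t : ℝ) (ha : 0 ≤ a) :
    verticalSymbol t a 0 = Real.cos (t * (2 * Real.pi * a)) := by
  simp [verticalSymbol, Real.sqrt_sq ha]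

theorem contDiff_verticalSymbol (t : ℝ) (ha : a ≠ 0) : ContDiff ℝ 2 (verticalSymbol t a) := by
  unfold verticalSymbol
  simp only [← mul_assoc]
  exact Complex.ofRealCLM.contDiff.comp (contDiff_cos_mul_sqrt_sq_add_sq ha _)

theorem norm_iteratedDeriv_verticalSymbol_le (t : ℝ) (ha : a ≠ 0) {j : ℕ} (hj : j ≤ 2) (κ : ℝ) :
    ‖iteratedDeriv j (verticalSymbol t a) κ‖ ≤ 1 + (t * (2 * Real.pi)) ^ 2 := by
  have hsymbol : verticalSymbol t a = Complex.ofRealLI ∘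
      fun κ => Real.cos (t * (2 * Real.pi) * √(a ^ 2 + κ ^ 2)) := by
    ext κ
    simp [verticalSymbol, mul_assoc]
  rw [hsymbol, ← norm_iteratedFDeriv_eq_norm_iteratedDeriv,
    Complex.ofRealLI.norm_iteratedFDeriv_comp_left
      (contDiff_cos_mul_sqrt_sq_add_sq ha _ (n := 2)).contDiffAt (by exact_mod_cast hj),
    norm_iteratedFDeriv_eq_norm_iteratedDeriv]
  exact abs_iteratedDeriv_cos_mul_sqrt_sq_add_sq_le ha _ hj κ

end VerticalSymbol

section VerticalIntegral

open MeasureTheory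
open scoped FourierTransform

section

variable {E : Type*} [NormedAddCommGroup E] [InnerProductSpace ℝ E] [FiniteDimensional ℝ E]
  [MeasurableSpace E] [BorelSpace E]

theorem integrable_schwartz_mul (u v : 𝓢(E, ℂ)) : Integrable fun k => u k * v k :=
  v.integrable.mul_of_top_right (u.memLp_top volume)

theorem integral_mul_standingWave (ψ h : 𝓢(E, ℂ)) (t : ℝ) :
    ∫ ξ, ψ ξ * standingWave h t ξ = ∫ k, h k * 𝓕 ψ k * Real.cos (t * (2 * Real.pi * ‖k‖)) := by
  have hint : Integrable fun k => Real.cos (t * (2 * Real.pi * ‖k‖)) • h k :=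
    h.integrable.bdd_smul (φ := fun k => Real.cos (t * (2 * Real.pi * ‖k‖))) 1 (by fun_prop)
      (.of_forall fun k => Real.abs_cos_le_one _)
  have hflip := VectorFourier.integral_fourierIntegral_smul_eq_flip (e := 𝐞) (μ := volume)
    (ν := volume) (L := innerₗ E) Real.continuous_fourierChar continuous_inner ψ.integrable
    hint
  rw [flip_innerₗ] at hflip
  calc _ = ∫ k, 𝓕 ψ k • (Real.cos (t * (2 * Real.pi * ‖k‖)) • h k) := hflip.symm
    _ = _ := by
      simp only [smul_eq_mul, Complex.real_smul]
      congr! 2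
      ring

end

theorem integral_space3 {F : Type*} [NormedAddCommGroup F] [NormedSpace ℝ F] (u : Space3 → F) :
    ∫ k, u k = ∫ q : Plane × ℝ, u (WithLp.toLp 2 q) :=
  ((WithLp.volume_preserving_toLp Plane ℝ).integral_comp
    (MeasurableEquiv.toLp 2 (Plane × ℝ)).measurableEmbedding u).symm

theorem fourier_testTensor (ψ : 𝓢(Plane, ℂ)) (hψ : HasCompactSupport ψ) (χ : 𝓢(ℝ, ℂ))
    (hχ : HasCompactSupport χ) (k : Plane) (κ : ℝ) :
    𝓕 (testTensor ψ hψ χ hχ) (WithLp.toLp 2 (k, κ)) = 𝓕 ψ k * 𝓕 χ κ := by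
  simp only [SchwartzMap.fourier_coe, Real.fourier_eq]
  rw [integral_space3, ← integral_prod_mul]
  refine integral_congr_ae (.of_forall fun q => ?_)
  have htensor : testTensor ψ hψ χ hχ (WithLp.toLp 2 q) = ψ q.1 * χ q.2 := rfl
  simp only [htensor, WithLp.prod_inner_apply, neg_add, AddChar.map_add_eq_mul,
    smul_mul_smul_comm]

theorem integrable_mul_verticalSymbol_mul (t : ℝ) {u : Plane → ℂ} (hu : Integrable u) {v : ℝ → ℂ}
    (hv : Integrable v) :
    Integrable fun q : Plane × ℝ => u q.1 * (verticalSymbol t ‖q.1‖ q.2 * v q.2) := by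
  have hcont : Continuous fun q : Plane × ℝ => verticalSymbol t ‖q.1‖ q.2 := by
    unfold verticalSymbol
    fun_prop
  refine ((hu.mul_prod hv).bdd_mul (c := 1) hcont.aestronglyMeasurable
    (.of_forall fun q => ?_)).congr (.of_forall fun q => mul_left_comm _ _ _)
  rw [verticalSymbol, Complex.norm_real]
  exact Real.abs_cos_le_one _

variable {f : Plane → ℝ} (hf : ContDiff ℝ ∞ f) (hc : HasCompactSupport f)

theorem planarWave_testTensor (t : ℝ) (ψ : 𝓢(Plane, ℂ)) (hψ : HasCompactSupport ψ) (χ : 𝓢(ℝ, ℂ))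
    (hχ : HasCompactSupport χ) :
    planarWave hf hc t (testTensor ψ hψ χ hχ) =
      ∫ k, 𝓕⁻ (complexTest f hf hc) k * 𝓕 ψ k * ∫ κ, verticalSymbol t ‖k‖ κ * 𝓕 χ κ := by
  have hint := integrable_mul_verticalSymbol_mul t
    (integrable_schwartz_mul (𝓕⁻ (complexTest f hf hc)) (𝓕 ψ)) (𝓕 χ : 𝓢(ℝ, ℂ)).integrable
  simp only [← integral_const_mul]
  rw [planarWave, cosineWave_apply, integral_space3, ← integral_prod _ hint]
  refine integral_congr_ae (.of_forall fun ⟨k, κ⟩ => ?_)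
  have hnorm : ‖(WithLp.toLp 2 (k, κ) : Space3)‖ = √(‖k‖ ^ 2 + κ ^ 2) := by
    simp only [WithLp.prod_norm_eq_of_L2, WithLp.toLp_fst, WithLp.toLp_snd, Real.norm_eq_abs,
      sq_abs]
  simp only [hnorm, WithLp.toLp_fst, fourier_testTensor, verticalSymbol, Complex.real_smul]
  ring

theorem tendsto_planarWave_testTensor (t : ℝ) (ψ : 𝓢(Plane, ℂ)) (hψ : HasCompactSupport ψ)
    {χ : ℕ → 𝓢(ℝ, ℂ)} (hχ : IsApproximateUnit χ) :
    Tendsto (fun n => planarWave hf hc t (testTensor ψ hψ (χ n) (hχ.compact n))) atTop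
      (𝓝 (∫ ξ, ψ ξ * standingWave (𝓕⁻ (complexTest f hf hc)) t ξ)) := by
  obtain ⟨C, hC⟩ := hχ.exists_norm_integral_mul_fourier_le
  have hsymbol {k : Plane} (hk : k ≠ 0) := contDiff_verticalSymbol t (norm_ne_zero_iff.2 hk)
  have hbound {k : Plane} (hk : k ≠ 0) := fun j (hj : j ≤ 2) =>
    norm_iteratedDeriv_verticalSymbol_le t (norm_ne_zero_iff.2 hk) hj
  have hint := integrable_schwartz_mul (𝓕⁻ (complexTest f hf hc)) (𝓕 ψ)
  simp only [planarWave_testTensor, integral_mul_standingWave]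
  refine tendsto_integral_of_dominated_convergence
    (fun k => ‖𝓕⁻ (complexTest f hf hc) k * 𝓕 ψ k‖ * (C * (1 + (t * (2 * Real.pi)) ^ 2)))
    (fun n => ?_) (hint.norm.mul_const _) (fun n => ?_) ?_
  · simp only [← integral_const_mul]
    exact (integrable_mul_verticalSymbol_mul t hint
      (𝓕 (χ n) : 𝓢(ℝ, ℂ)).integrable).integral_prod_left.aestronglyMeasurable
  · filter_upwards [volume.ae_ne (0 : Plane)] with k hk
    rw [norm_mul]
    gcongr
    exact hC _ _ (hsymbol hk) (hbound hk) n
  · filter_upwards [volume.ae_ne (0 : Plane)] with k hk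
    have hlim := hχ.tendsto_integral_mul_fourier (hsymbol hk) (hbound hk)
    rw [verticalSymbol_zero t (norm_nonneg k)] at hlim
    exact hlim.const_mul _

theorem fourier_fourierInv_complexTest (ξ : Plane) :
    𝓕 (𝓕⁻ (complexTest f hf hc)) ξ = f ξ := by
  rw [FourierTransform.fourier_fourierInv_eq (F := 𝓢(Plane, ℂ))]
  rfl

theorem IsDistributionalWaveSolution.exists_isVerticallyIntegrated_standingWave
    {p : ℝ → 𝓢'(Space3, ℂ)} (hp : IsDistributionalWaveSolution p (planarSource f hf hc)) :
    ∃ h : 𝓢(Plane, ℂ), (∀ ξ, 𝓕 h ξ = f ξ) ∧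
      IsVerticallyIntegrated p fun ξ t => (standingWave h t ξ).re := by
  have hsource := fourier_fourierInv_complexTest hf hc
  refine ⟨𝓕⁻ (complexTest f hf hc), hsource, fun t ht =>
    ⟨Complex.continuous_re.comp (continuous_standingWave _).curry_left, fun ψ hψ χ hχ => ?_⟩⟩
  rw [hp.unique (isDistributionalWaveSolution_planarWave hf hc) ht]
  simp only [ofReal_re_standingWave _ hsource]
  exact tendsto_planarWave_testTensor hf hc t ψ hψ hχ

theorem exists_isApproximateUnit : ∃ χ : ℕ → 𝓢(ℝ, ℂ), IsApproximateUnit χ := by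
  let b : ContDiffBump (0 : ℝ) := ⟨1, 2, one_pos, one_lt_two⟩
  have hb : HasCompactSupport fun z => (b z : ℂ) :=
    b.hasCompactSupport.comp_left (g := fun y : ℝ => (y : ℂ)) Complex.ofReal_zero
  let χ₀ : 𝓢(ℝ, ℂ) := hb.toSchwartzMap (Complex.ofRealCLM.contDiff.comp b.contDiff)
  have hc (n : ℕ) : HasCompactSupport fun z : ℝ => χ₀ ((n + 1 : ℝ)⁻¹ * z) :=
    (show HasCompactSupport χ₀ from hb).comp_smul (c := (n + 1 : ℝ)⁻¹) (by positivity)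
  have hs (n : ℕ) : ContDiff ℝ ∞ fun z : ℝ => χ₀ ((n + 1 : ℝ)⁻¹ * z) :=
    (χ₀.smooth ⊤).comp (contDiff_const.mul contDiff_id)
  refine ⟨fun n => (hc n).toSchwartzMap (hs n), hc, fun R => ?_, fun k => ?_⟩
  · filter_upwards [eventually_ge_atTop ⌈R⌉₊] with n hn z hz
    change ((b ((n + 1 : ℝ)⁻¹ * z) : ℝ) : ℂ) = 1
    rw [b.one_of_mem_closedBall, Complex.ofReal_one]
    rw [mem_closedBall_zero_iff, norm_mul, norm_inv, Real.norm_eq_abs z,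
      Real.norm_of_nonneg (by positivity)]
    change _ ≤ (1 : ℝ)
    rw [inv_mul_le_one₀ (by positivity)]
    linarith [Nat.ceil_le.1 hn]
  · obtain ⟨C, -, hC⟩ := χ₀.decay 0 k
    refine ⟨C, fun n z => ?_⟩
    have hscale : ‖((n + 1 : ℝ)⁻¹) ^ k‖ ≤ 1 := by
      rw [norm_pow, norm_inv, Real.norm_of_nonneg (by positivity)]
      exact pow_le_one₀ (by positivity) (inv_le_one_of_one_le₀ (by simp))
    change ‖iteratedDeriv k (fun z : ℝ => χ₀ ((n + 1 : ℝ)⁻¹ * z)) z‖ ≤ C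
    rw [iteratedDeriv_comp_const_smul (χ₀.smooth k), norm_smul,
      ← norm_iteratedFDeriv_eq_norm_iteratedDeriv]
    exact (mul_le_of_le_one_left (norm_nonneg _) hscale).trans
      (by simpa using hC ((n + 1 : ℝ)⁻¹ * z))

theorem HasVerticalIntegral.unique {T : 𝓢'(Space3, ℂ)} {g₁ g₂ : Plane → ℝ}
    (h₁ : HasVerticalIntegral T g₁) (h₂ : HasVerticalIntegral T g₂) : g₁ = g₂ := by
  obtain ⟨χ, hχ⟩ := exists_isApproximateUnit
  rw [← Continuous.ae_eq_iff_eq volume h₁.1 h₂.1]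
  refine ae_eq_of_integral_contDiff_smul_eq h₁.1.locallyIntegrable h₂.1.locallyIntegrable
    fun ψ hψ hψc => ?_
  have hc : HasCompactSupport (complexTest ψ hψ hψc) :=
    hψc.comp_left (g := fun y : ℝ => (y : ℂ)) Complex.ofReal_zero
  have hcomplex := tendsto_nhds_unique (h₁.2 _ hc χ hχ) (h₂.2 _ hc χ hχ)
  have happly (ξ : Plane) : complexTest ψ hψ hψc ξ = ψ ξ := rfl
  simp only [happly, ← Complex.ofReal_mul, integral_complex_ofReal] at hcomplex
  exact Complex.ofReal_injective hcomplex

theorem IsVerticallyIntegrated.unique {p : ℝ → 𝓢'(Space3, ℂ)} {P Q : Plane → ℝ → ℝ}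
    (hP : IsVerticallyIntegrated p P) (hQ : IsVerticallyIntegrated p Q) {t : ℝ} (ht : 0 ≤ t)
    (ξ : Plane) : P ξ t = Q ξ t :=
  congrFun ((hP t ht).unique (hQ t ht)) ξ

end VerticalIntegral

/-! ### Abel transforms and circular means -/

section AbelTransform

open MeasureTheory Set Real

/-- `∫₀^τ g(t) / √(τ² - t²) dt` after the substitution `t = τ sin φ`, which removes the singularity
and makes sense of the integral for every real `τ`. -/
def sineIntegral (g : ℝ → ℝ) (τ : ℝ) : ℝ := ∫ φ in (0 : ℝ)..(π / 2), g (τ * sin φ)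

theorem continuous_sineIntegral {g : ℝ → ℝ} (hg : Continuous g) : Continuous (sineIntegral g) :=
  intervalIntegral.continuous_parametric_intervalIntegral_of_continuous'
    (by fun_prop) _ _

theorem image_sin_Ioo {r : ℝ} (hr : 0 < r) :
    (fun φ => r * sin φ) '' Ioo 0 (π / 2) = Ioo 0 r := by
  ext t
  constructor
  · rintro ⟨φ, ⟨h0, h1⟩, rfl⟩
    have hs : 0 < sin φ := sin_pos_of_pos_of_lt_pi h0 (by linarith [pi_pos])
    have hs1 : sin φ < 1 := by
      rw [← sin_pi_div_two]
      exact sin_lt_sin_of_lt_of_le_pi_div_two (by linarith) le_rfl h1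
    exact ⟨by positivity, by nlinarith⟩
  · rintro ⟨h0, h1⟩
    have ht : 0 < t / r := by positivity
    have ht1 : t / r < 1 := (div_lt_one hr).2 h1
    refine ⟨arcsin (t / r), ⟨arcsin_pos.2 ht, arcsin_lt_pi_div_two.2 ht1⟩, ?_⟩
    simp only
    rw [sin_arcsin (by linarith) ht1.le]
    field_simp

variable {g G : ℝ → ℝ} {r : ℝ}

theorem injOn_mul_sin (hr : 0 < r) : InjOn (fun φ => r * sin φ) (Ioo 0 (π / 2)) := by
  intro x hx y hy h
  refine injOn_sin ⟨?_, hx.2.le⟩ ⟨?_, hy.2.le⟩ (mul_left_cancel₀ hr.ne' h)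
  · linarith [hx.1, pi_pos]
  · linarith [hy.1, pi_pos]

theorem abs_deriv_smul_sine_substitution (hr : 0 < r) (hG : EqOn G g (Ioi 0)) {φ : ℝ}
    (hφ : φ ∈ Ioo 0 (π / 2)) :
    |r * cos φ| • (G (r * sin φ) / √(r ^ 2 - (r * sin φ) ^ 2)) = g (r * sin φ) := by
  have hs : 0 < sin φ := sin_pos_of_pos_of_lt_pi hφ.1 (by linarith [pi_pos, hφ.2])
  have hc : 0 < cos φ := cos_pos_of_mem_Ioo ⟨by linarith [hφ.1, pi_pos], hφ.2⟩
  have h : r ^ 2 - (r * sin φ) ^ 2 = (r * cos φ) ^ 2 := by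
    rw [mul_pow, mul_pow, cos_sq']
    ring
  rw [h, sqrt_sq (by positivity), abs_of_pos (by positivity), smul_eq_mul,
    hG (mem_Ioi.2 (by positivity : 0 < r * sin φ))]
  field_simp

theorem intervalIntegrable_div_sqrt (hg : Continuous g) (hr : 0 < r)
    (hG : EqOn G g (Ioi 0)) :
    IntervalIntegrable (fun t => G t / √(r ^ 2 - t ^ 2)) volume 0 r := by
  rw [intervalIntegrable_iff_integrableOn_Ioo_of_le hr.le, ← image_sin_Ioo hr,
    integrableOn_image_iff_integrableOn_abs_deriv_smul measurableSet_Ioo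
      (fun x _ => ((hasDerivAt_sin x).const_mul r).hasDerivWithinAt) (injOn_mul_sin hr)]
  refine IntegrableOn.congr_fun ?_ (fun φ hφ =>
    (abs_deriv_smul_sine_substitution hr hG hφ).symm) measurableSet_Ioo
  have : Continuous fun φ => g (r * sin φ) := by fun_prop
  exact (this.integrableOn_Icc (a := 0) (b := π / 2)).mono_set Ioo_subset_Icc_self

theorem integral_div_sqrt (hr : 0 < r) (hG : EqOn G g (Ioi 0)) :
    ∫ t in (0 : ℝ)..r, G t / √(r ^ 2 - t ^ 2) = sineIntegral g r := by
  rw [intervalIntegral.integral_of_le hr.le, integral_Ioc_eq_integral_Ioo, ← image_sin_Ioo hr,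
    integral_image_eq_integral_abs_deriv_smul measurableSet_Ioo
      (fun x _ => ((hasDerivAt_sin x).const_mul r).hasDerivWithinAt) (injOn_mul_sin hr),
    setIntegral_congr_fun measurableSet_Ioo
      fun φ hφ => abs_deriv_smul_sine_substitution hr hG hφ, sineIntegral,
    intervalIntegral.integral_of_le (by positivity), integral_Ioc_eq_integral_Ioo]

theorem abs_deriv_smul_tan_substitution (hr : 0 < r) (hG : EqOn G g (Ioi 0)) {θ : ℝ}
    (hθ : θ ∈ Ioo (-(π / 2)) (π / 2)) :
    |r⁻¹ * (1 / cos θ ^ 2)| • (G (1 / √((r⁻¹ * tan θ) ^ 2 + (1 / r) ^ 2)) /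
      √((r⁻¹ * tan θ) ^ 2 + (1 / r) ^ 2) ^ 2) = r * g (r * cos θ) := by
  have hc : 0 < cos θ := cos_pos_of_mem_Ioo hθ
  have h : (r⁻¹ * tan θ) ^ 2 + (1 / r) ^ 2 = (1 / (r * cos θ)) ^ 2 := by
    rw [tan_eq_sin_div_cos]
    field_simp
    linarith [sin_sq_add_cos_sq θ]
  rw [h, sqrt_sq (by positivity), one_div_one_div, hG (mem_Ioi.2 (by positivity : 0 < r * cos θ)),
    abs_of_pos (by positivity), smul_eq_mul]
  field_simp

theorem image_tan_Ioo_const_mul (hr : 0 < r) :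
    (fun θ => r⁻¹ * tan θ) '' Ioo (-(π / 2)) (π / 2) = univ := by
  refine eq_univ_of_forall fun u => ?_
  obtain ⟨θ, hθ, h⟩ : r * u ∈ tan '' Ioo (-(π / 2)) (π / 2) := by
    rw [image_tan_Ioo]
    trivial
  refine ⟨θ, hθ, ?_⟩
  simp only [h]
  field_simp

theorem injOn_mul_tan (hr : 0 < r) :
    InjOn (fun θ => r⁻¹ * tan θ) (Ioo (-(π / 2)) (π / 2)) := fun _ hx _ hy h =>
  injOn_tan hx hy (mul_left_cancel₀ (inv_ne_zero hr.ne') h)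

theorem hasDerivWithinAt_mul_tan {θ : ℝ} (hθ : θ ∈ Ioo (-(π / 2)) (π / 2)) :
    HasDerivWithinAt (fun θ => r⁻¹ * tan θ) (r⁻¹ * (1 / cos θ ^ 2)) (Ioo (-(π / 2)) (π / 2)) θ :=
  ((hasDerivAt_tan (cos_pos_of_mem_Ioo hθ).ne').const_mul _).hasDerivWithinAt

theorem integrable_abelIntegrand (hg : Continuous g) (hr : 0 < r) (hG : EqOn G g (Ioi 0)) :
    Integrable fun u : ℝ => G (1 / √(u ^ 2 + (1 / r) ^ 2)) / √(u ^ 2 + (1 / r) ^ 2) ^ 2 := by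
  rw [← integrableOn_univ, ← image_tan_Ioo_const_mul hr,
    integrableOn_image_iff_integrableOn_abs_deriv_smul measurableSet_Ioo
      (fun x hx => hasDerivWithinAt_mul_tan hx) (injOn_mul_tan hr)]
  refine IntegrableOn.congr_fun ?_ (fun φ hφ =>
    (abs_deriv_smul_tan_substitution hr hG hφ).symm) measurableSet_Ioo
  have : Continuous fun θ => r * g (r * cos θ) := by fun_prop
  exact (this.integrableOn_Icc (a := -(π / 2)) (b := π / 2)).mono_set Ioo_subset_Icc_self

theorem integral_sin_zero_pi (hg : Continuous g) :
    ∫ φ in (0 : ℝ)..π, g (r * sin φ) = 2 * sineIntegral g r := by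
  have hc : Continuous fun φ => g (r * sin φ) := by fun_prop
  rw [← intervalIntegral.integral_add_adjacent_intervals (hc.intervalIntegrable 0 (π / 2))
    (hc.intervalIntegrable (π / 2) π)]
  have h := intervalIntegral.integral_comp_sub_left (fun φ => g (r * sin φ)) (a := 0) (b := π / 2) π
  simp only [sin_pi_sub, sub_zero, show π - π / 2 = π / 2 by ring] at h
  rw [← h, sineIntegral]
  ring

theorem integral_sin_zero_two_pi (hg : Continuous g) (heven : ∀ s, g (-s) = g s) :
    ∫ φ in (0 : ℝ)..(2 * π), g (r * sin φ) = 4 * sineIntegral g r := by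
  have hc : Continuous fun φ => g (r * sin φ) := by fun_prop
  rw [← intervalIntegral.integral_add_adjacent_intervals (hc.intervalIntegrable 0 π)
    (hc.intervalIntegrable π (2 * π))]
  have h := intervalIntegral.integral_comp_add_right (fun φ => g (r * sin φ)) (a := 0) (b := π) π
  simp only [sin_add_pi, mul_neg, heven, zero_add, ← two_mul] at h
  rw [← h, integral_sin_zero_pi hg]
  ring

theorem abelTransform_eq (hg : Continuous g) (hr : 0 < r) (hG : EqOn G g (Ioi 0)) :
    abelTransform (fun s => G (1 / s) / s ^ 2) (1 / r) = r * (2 * sineIntegral g r) := by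
  rw [abelTransform, ← setIntegral_univ, ← image_tan_Ioo_const_mul hr,
    integral_image_eq_integral_abs_deriv_smul measurableSet_Ioo
      (fun x hx => hasDerivWithinAt_mul_tan hx) (injOn_mul_tan hr),
    setIntegral_congr_fun measurableSet_Ioo
      fun φ hφ => abs_deriv_smul_tan_substitution hr hG hφ,
    ← integral_Ioc_eq_integral_Ioo, ← intervalIntegral.integral_of_le (by linarith [pi_pos]),
    intervalIntegral.integral_const_mul, ← integral_sin_zero_pi hg]
  have h := intervalIntegral.integral_comp_add_right (fun φ => g (r * sin φ))
    (a := -(π / 2)) (b := π / 2) (π / 2)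
  simp only [sin_add_pi_div_two, neg_add_cancel, add_halves] at h
  rw [h]

theorem sineIntegral_pow (n : ℕ) (τ : ℝ) :
    sineIntegral (fun s => s ^ n) τ = τ ^ n * ∫ φ in (0 : ℝ)..(π / 2), sin φ ^ n := by
  simp only [sineIntegral, mul_pow, intervalIntegral.integral_const_mul]

theorem integral_sin_pow_mul_integral_sin_pow_succ (n : ℕ) :
    (∫ φ in (0 : ℝ)..(π / 2), sin φ ^ n) * (∫ φ in (0 : ℝ)..(π / 2), sin φ ^ (n + 1)) =
      π / 2 / (n + 1) := by
  induction n with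
  | zero => simp
  | succ n ih =>
    rw [integral_sin_pow n]
    simp only [sin_zero, cos_pi_div_two, mul_zero, ne_eq, Nat.add_eq_zero_iff, one_ne_zero,
      and_false, not_false_eq_true, zero_pow, zero_mul, sub_zero, zero_div, zero_add]
    rw [mul_left_comm, mul_comm (∫ φ in (0 : ℝ)..(π / 2), sin φ ^ (n + 1)), ih]
    push_cast
    field_simp
    ring

/-- The difference of the two sides of Archimedes' hat-box theorem, which evaluates the integral
over the unit sphere of a function `g` of one Cartesian coordinate. -/
def hatBoxDefect (g : ℝ → ℝ) : ℝ :=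
  (∫ θ in (0 : ℝ)..(π / 2), sin θ * sineIntegral g (sin θ)) - π / 2 * ∫ s in (0 : ℝ)..1, g s

theorem hatBoxDefect_add {g h : ℝ → ℝ} (hg : Continuous g) (hh : Continuous h) :
    hatBoxDefect (fun s => g s + h s) = hatBoxDefect g + hatBoxDefect h := by
  have hsine : ∀ τ, sineIntegral (fun s => g s + h s) τ = sineIntegral g τ + sineIntegral h τ :=
    fun τ => intervalIntegral.integral_add (Continuous.intervalIntegrable (by fun_prop) _ _)
      (Continuous.intervalIntegrable (by fun_prop) _ _)
  have hgs := continuous_sineIntegral hg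
  have hhs := continuous_sineIntegral hh
  simp only [hatBoxDefect, hsine, mul_add]
  rw [intervalIntegral.integral_add (Continuous.intervalIntegrable (by fun_prop) _ _)
      (Continuous.intervalIntegrable (by fun_prop) _ _),
    intervalIntegral.integral_add (hg.intervalIntegrable _ _) (hh.intervalIntegrable _ _)]
  ring

theorem hatBoxDefect_const_mul (c : ℝ) (g : ℝ → ℝ) :
    hatBoxDefect (fun s => c * g s) = c * hatBoxDefect g := by
  simp only [hatBoxDefect, sineIntegral, intervalIntegral.integral_const_mul, mul_left_comm _ c]
  ring

theorem hatBoxDefect_pow (n : ℕ) : hatBoxDefect (fun s => s ^ n) = 0 := by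
  simp only [hatBoxDefect, sineIntegral_pow, ← mul_assoc, ← pow_succ',
    intervalIntegral.integral_mul_const, integral_pow]
  rw [mul_comm, integral_sin_pow_mul_integral_sin_pow_succ]
  simp [div_eq_mul_inv]

theorem hatBoxDefect_polynomial (p : Polynomial ℝ) : hatBoxDefect (fun s => p.eval s) = 0 := by
  induction p using Polynomial.induction_on' with
  | add p q hp hq =>
    simp only [Polynomial.eval_add]
    rw [hatBoxDefect_add p.continuous q.continuous, hp, hq, add_zero]
  | monomial n a =>
    simp only [Polynomial.eval_monomial]
    rw [hatBoxDefect_const_mul, hatBoxDefect_pow, mul_zero]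

theorem abs_hatBoxDefect_le {g : ℝ → ℝ} {ε : ℝ} (hg : ∀ s ∈ Icc (0 : ℝ) 1, |g s| ≤ ε) :
    |hatBoxDefect g| ≤ ((π / 2) ^ 2 + π / 2) * ε := by
  have hsin : ∀ φ ∈ uIoc (0 : ℝ) (π / 2), sin φ ∈ Icc (0 : ℝ) 1 := fun φ hφ => by
    rw [uIoc_of_le (by positivity)] at hφ
    exact ⟨sin_nonneg_of_nonneg_of_le_pi hφ.1.le (by linarith [hφ.2, pi_pos]), sin_le_one φ⟩
  have hsine : ∀ τ ∈ Icc (0 : ℝ) 1, |sineIntegral g τ| ≤ ε * (π / 2) := fun τ hτ => by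
    have := intervalIntegral.norm_integral_le_of_norm_le_const (a := 0) (b := π / 2)
      (f := fun φ => g (τ * sin φ)) (C := ε) fun φ hφ => hg _
        ⟨mul_nonneg hτ.1 (hsin φ hφ).1, mul_le_one₀ hτ.2 (hsin φ hφ).1 (hsin φ hφ).2⟩
    rwa [sub_zero, abs_of_nonneg (by positivity : (0 : ℝ) ≤ π / 2)] at this
  have hsphere := intervalIntegral.norm_integral_le_of_norm_le_const (a := 0) (b := π / 2)
    (f := fun θ => sin θ * sineIntegral g (sin θ)) (C := ε * (π / 2)) fun θ hθ => by
      rw [norm_mul, norm_eq_abs, norm_eq_abs, abs_of_nonneg (hsin θ hθ).1]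
      exact (mul_le_of_le_one_left (abs_nonneg _) (hsin θ hθ).2).trans (hsine _ (hsin θ hθ))
  have hline := intervalIntegral.norm_integral_le_of_norm_le_const (a := (0 : ℝ)) (b := 1)
    (f := g) (C := ε) fun s hs => hg s (by
      rw [uIoc_of_le zero_le_one] at hs
      exact ⟨hs.1.le, hs.2⟩)
  rw [sub_zero, abs_of_nonneg (by positivity : (0 : ℝ) ≤ π / 2)] at hsphere
  rw [sub_zero, abs_one, mul_one] at hline
  calc |hatBoxDefect g| ≤ ε * (π / 2) * (π / 2) + π / 2 * ε := by
        refine (abs_sub _ _).trans (add_le_add hsphere ?_)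
        rw [abs_mul, abs_of_nonneg (by positivity : (0 : ℝ) ≤ π / 2)]
        gcongr
        exact hline
    _ = _ := by ring

theorem integral_sin_mul_sineIntegral {g : ℝ → ℝ} (hg : Continuous g) :
    ∫ θ in (0 : ℝ)..(π / 2), sin θ * sineIntegral g (sin θ) = π / 2 * ∫ s in (0 : ℝ)..1, g s := by
  suffices h : hatBoxDefect g = 0 from sub_eq_zero.1 h
  have hK : 0 < (π / 2) ^ 2 + π / 2 := by positivity
  refine abs_nonpos_iff.1 (le_of_forall_pos_le_add fun δ hδ => ?_)
  obtain ⟨p, hp⟩ := exists_polynomial_near_of_continuousOn 0 1 g hg.continuousOn _ (div_pos hδ hK)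
  have happrox := hatBoxDefect_add p.continuous (hg.sub p.continuous)
  simp only [Pi.sub_apply, add_sub_cancel, hatBoxDefect_polynomial, zero_add] at happrox
  calc |hatBoxDefect g| = |hatBoxDefect (g - fun s => p.eval s)| := by rw [happrox]
    _ ≤ ((π / 2) ^ 2 + π / 2) * (δ / ((π / 2) ^ 2 + π / 2)) :=
        abs_hatBoxDefect_le fun s hs => by
          rw [Pi.sub_apply, abs_sub_comm]
          exact (hp s hs).le
    _ = 0 + δ := by
        field_simp
        ring

theorem integral_mul_sineIntegral_div_sqrt {g : ℝ → ℝ} (hg : Continuous g) {τ : ℝ} (hτ : 0 < τ) :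
    ∫ r in (0 : ℝ)..τ, r * (2 / π * sineIntegral g r) / √(τ ^ 2 - r ^ 2) =
      ∫ s in (0 : ℝ)..τ, g s := by
  have hbox := integral_sin_mul_sineIntegral (g := fun s => g (τ * s)) (by fun_prop)
  have hscale : ∀ θ, sineIntegral (fun s => g (τ * s)) (sin θ) = sineIntegral g (τ * sin θ) :=
    fun θ => by simp only [sineIntegral, mul_assoc]
  simp only [hscale] at hbox
  rw [integral_div_sqrt (g := fun r => r * (2 / π * sineIntegral g r)) hτ (eqOn_refl _ _)]
  simp only [sineIntegral] at hbox ⊢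
  calc _ = ∫ θ in (0 : ℝ)..(π / 2), (τ * (2 / π)) *
        (sin θ * ∫ φ in (0 : ℝ)..(π / 2), g (τ * sin θ * sin φ)) := by
        congr 1 with θ
        ring
    _ = τ * ∫ s in (0 : ℝ)..1, g (τ * s) := by
        rw [intervalIntegral.integral_const_mul, hbox]
        field_simp
    _ = _ := by
        rw [← smul_eq_mul, intervalIntegral.smul_integral_comp_mul_left]
        simp

end AbelTransform

section CircularMeans

open MeasureTheory Set FourierTransform

@[fun_prop]
theorem continuous_circle : Continuous fun α : ℝ => !₂[Real.cos α, Real.sin α] := by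
  refine (PiLp.continuous_toLp 2 _).comp (continuous_pi fun i => ?_)
  fin_cases i
  exacts [Real.continuous_cos, Real.continuous_sin]

theorem exists_inner_circle_eq (k : Plane) :
    ∃ γ : ℝ, ∀ α : ℝ, inner ℝ k !₂[Real.cos α, Real.sin α] = ‖k‖ * Real.sin (α + γ) := by
  have hcos := Complex.norm_mul_cos_arg ⟨k 1, k 0⟩
  have hsin := Complex.norm_mul_sin_arg ⟨k 1, k 0⟩
  have hnorm : ‖(⟨k 1, k 0⟩ : ℂ)‖ = ‖k‖ := by
    rw [EuclideanSpace.norm_eq, Complex.norm_eq_sqrt_sq_add_sq]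
    simp only [Real.norm_eq_abs, sq_abs, Fin.sum_univ_two, add_comm]
  rw [hnorm] at hcos hsin
  refine ⟨Complex.arg ⟨k 1, k 0⟩, fun α => ?_⟩
  rw [Real.sin_add]
  simp only [PiLp.inner_apply, Fin.sum_univ_two, Real.inner_apply, Matrix.cons_val_zero,
    Matrix.cons_val_one]
  linear_combination -Real.cos α * hsin - Real.sin α * hcos

theorem integral_comp_add_of_periodic {F : Type*} [NormedAddCommGroup F] [NormedSpace ℝ F]
    {g : ℝ → F} {T : ℝ} (hg : Function.Periodic g T) (γ : ℝ) :
    ∫ α in (0 : ℝ)..T, g (α + γ) = ∫ α in (0 : ℝ)..T, g α := by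
  rw [intervalIntegral.integral_comp_add_right, zero_add, add_comm T,
    hg.intervalIntegral_add_eq γ 0, zero_add]

theorem integral_fourierChar_mul_sin (a : ℝ) :
    ∫ α in (0 : ℝ)..(2 * Real.pi), (𝐞 (-(a * Real.sin α)) : ℂ) =
      ∫ α in (0 : ℝ)..(2 * Real.pi), (Real.cos (2 * Real.pi * a * Real.sin α) : ℂ) := by
  have hodd : ∫ α in (0 : ℝ)..(2 * Real.pi), Real.sin (2 * Real.pi * a * Real.sin α) = 0 := by
    have hshift := integral_comp_add_of_periodic
      (g := fun α => Real.sin (2 * Real.pi * a * Real.sin α)) (T := 2 * Real.pi)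
      (fun α => by simp only [Real.sin_add_two_pi]) Real.pi
    simp only [Real.sin_add_pi, mul_neg, Real.sin_neg, intervalIntegral.integral_neg] at hshift
    linarith
  have heuler (α : ℝ) : (𝐞 (-(a * Real.sin α)) : ℂ) =
      (Real.cos (2 * Real.pi * a * Real.sin α) : ℂ) -
        (Real.sin (2 * Real.pi * a * Real.sin α) : ℂ) * Complex.I := by
    rw [Real.fourierChar_apply, mul_neg, ← mul_assoc, Complex.ofReal_neg, Complex.exp_mul_I,
      Complex.cos_neg, Complex.sin_neg, Complex.ofReal_cos, Complex.ofReal_sin, neg_mul,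
      sub_eq_add_neg]
  simp only [heuler]
  rw [intervalIntegral.integral_sub (Continuous.intervalIntegrable (by fun_prop) _ _)
    (Continuous.intervalIntegrable (by fun_prop) _ _), intervalIntegral.integral_mul_const,
    intervalIntegral.integral_ofReal, intervalIntegral.integral_ofReal, hodd, Complex.ofReal_zero,
    zero_mul, sub_zero]

theorem integral_fourierChar_inner_circle (k : Plane) (r : ℝ) :
    ∫ α in (0 : ℝ)..(2 * Real.pi), (𝐞 (-inner ℝ k (r • !₂[Real.cos α, Real.sin α])) : ℂ) =
      ∫ α in (0 : ℝ)..(2 * Real.pi), (Real.cos (r * Real.sin α * (2 * Real.pi * ‖k‖)) : ℂ) := by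
  obtain ⟨γ, hγ⟩ := exists_inner_circle_eq k
  simp only [inner_smul_right, hγ, ← mul_assoc]
  rw [integral_comp_add_of_periodic (g := fun α => (𝐞 (-(r * ‖k‖ * Real.sin α)) : ℂ))
    (fun α => by simp only [Real.sin_add_two_pi]), integral_fourierChar_mul_sin]
  congr 1 with α
  ring_nf

variable (h : 𝓢(Plane, ℂ))

theorem integral_fourier_circle (ξ : Plane) (r : ℝ) :
    ∫ α in (0 : ℝ)..(2 * Real.pi), 𝓕 h (ξ + r • !₂[Real.cos α, Real.sin α]) =
      ∫ α in (0 : ℝ)..(2 * Real.pi), standingWave h (r * Real.sin α) ξ := by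
  have hint {c : ℝ → Plane → ℂ} (hc : Continuous (Function.uncurry c)) (hc1 : ∀ α k, ‖c α k‖ ≤ 1) :
      Integrable (Function.uncurry fun α k => c α k * (𝐞 (-inner ℝ k ξ) • h k))
        ((volume.restrict (uIoc 0 (2 * Real.pi))).prod volume) := by
    have hprod : Integrable (fun q : ℝ × Plane => (1 : ℂ) * (𝐞 (-inner ℝ q.2 ξ) • h q.2))
        ((volume.restrict (uIoc 0 (2 * Real.pi))).prod volume) :=
      (intervalIntegrable_iff.1 (intervalIntegrable_const (c := (1 : ℂ)))).mul_prod
        ((Real.fourierIntegral_convergent_iff ξ).2 h.integrable)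
    simp only [one_mul] at hprod
    exact hprod.bdd_mul (c := 1) hc.aestronglyMeasurable (.of_forall fun q => hc1 q.1 q.2)
  have hsource (α : ℝ) : 𝓕 h (ξ + r • !₂[Real.cos α, Real.sin α]) = ∫ k,
      (𝐞 (-inner ℝ k (r • !₂[Real.cos α, Real.sin α])) : ℂ) * (𝐞 (-inner ℝ k ξ) • h k) := by
    rw [SchwartzMap.fourier_coe, Real.fourier_eq]
    refine integral_congr_ae (.of_forall fun k => ?_)
    simp only [inner_add_right, neg_add, AddChar.map_add_eq_mul, mul_smul, Circle.smul_def,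
      smul_eq_mul]
    ring
  simp only [hsource, standingWave_apply, Complex.real_smul]
  rw [intervalIntegral_integral_swap (hint (by fun_prop) fun α k => (Circle.norm_coe _).le),
    intervalIntegral_integral_swap (hint (by fun_prop) fun α k => ?_)]
  · simp only [intervalIntegral.integral_mul_const, integral_fourierChar_inner_circle]
  · rw [Complex.norm_real]
    exact Real.abs_cos_le_one _

theorem circularMean_eq_sineIntegral {f : Plane → ℝ} (hf : ∀ x, 𝓕 h x = f x) (ξ : Plane) (r : ℝ) :
    circularMean f ξ r = 2 / Real.pi * sineIntegral (fun t => (standingWave h t ξ).re) r := by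
  have hcirc : ∫ α in (0 : ℝ)..(2 * Real.pi), f (ξ + r • !₂[Real.cos α, Real.sin α]) =
      ∫ α in (0 : ℝ)..(2 * Real.pi), (standingWave h (r * Real.sin α) ξ).re := by
    apply Complex.ofReal_injective
    simpa only [← intervalIntegral.integral_ofReal, ofReal_re_standingWave h hf, ← hf] using
      integral_fourier_circle h ξ r
  have heven (t : ℝ) : (standingWave h (-t) ξ).re = (standingWave h t ξ).re := by
    simp only [standingWave, neg_mul, Real.cos_neg]
  have hcont : Continuous fun t => (standingWave h t ξ).re :=
    Complex.continuous_re.comp (continuous_standingWave h).curry_right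
  rw [circularMean, hcirc, integral_sin_zero_two_pi hcont heven]
  field_simp
  ring

end CircularMeans

section
open Set

theorem hasDerivAt_integral_mul_sineIntegral_div_sqrt {g G : ℝ → ℝ} (hg : Continuous g)
    (hG : EqOn G g (Ioi 0)) {t : ℝ} (ht : 0 < t) :
    HasDerivAt (fun τ : ℝ => ∫ r in (0 : ℝ)..τ,
      r * (2 / Real.pi * sineIntegral g r) / √(τ ^ 2 - r ^ 2)) (G t) t := by
  rw [hG ht]
  have hftc := intervalIntegral.integral_hasDerivAt_right (hg.intervalIntegrable 0 t)
    (hg.stronglyMeasurableAtFilter _ _) hg.continuousAt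
  refine hftc.congr_of_eventuallyEq ?_
  filter_upwards [lt_mem_nhds ht] with τ hτ using integral_mul_sineIntegral_div_sqrt hg hτ

end
end Photoacoustic
end

open Photoacoustic MeasureTheory Set in
theorem mainTheorem4_general (S : Set Plane) (f : Plane → ℝ) (hf : ContDiff ℝ ∞ f)
    (hf_compact : HasCompactSupport f) (p : ℝ → 𝓢'(Space3, ℂ))
    (hp : IsDistributionalWaveSolution p (planarSource f hf hf_compact)) :
    (∃ P : Plane → ℝ → ℝ, IsVerticallyIntegrated p P) ∧
    ∀ P : Plane → ℝ → ℝ, IsVerticallyIntegrated p P →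
      IsClassicalWaveSolution P f ∧
      (∀ ξ : Plane, ∀ r : ℝ, 0 < r →
        Integrable (fun u : ℝ => P ξ (1 / √(u ^ 2 + (1 / r) ^ 2)) / √(u ^ 2 + (1 / r) ^ 2) ^ 2) ∧
        circularMean f ξ r =
          1 / (Real.pi * r) * abelTransform (fun s => P ξ (1 / s) / s ^ 2) (1 / r) ∧
        IntervalIntegrable (fun t => P ξ t / √(r ^ 2 - t ^ 2)) volume 0 r ∧
        circularMean f ξ r = 2 / Real.pi * ∫ t in (0 : ℝ)..r, P ξ t / √(r ^ 2 - t ^ 2)) ∧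
      ∀ m₁ : S → ℝ → ℝ, (∀ ξ : S, ∀ t : ℝ, 0 < t → m₁ ξ t = P ξ t) →
        (∀ ξ : S, ∀ r : ℝ, 0 < r →
          IntervalIntegrable (fun t => m₁ ξ t / √(r ^ 2 - t ^ 2)) volume 0 r ∧
          circularMean f ξ r = 2 / Real.pi * ∫ t in (0 : ℝ)..r, m₁ ξ t / √(r ^ 2 - t ^ 2)) ∧
        (∀ ξ : S, ∀ t : ℝ, 0 < t →
          HasDerivAt
            (fun τ : ℝ => ∫ r in (0 : ℝ)..τ, r * circularMean f ξ r / √(τ ^ 2 - r ^ 2))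
            (m₁ ξ t) t) := by
  obtain ⟨h, hsource, hvert⟩ := hp.exists_isVerticallyIntegrated_standingWave
  have hcont (ξ) : Continuous fun t => (standingWave h t ξ).re :=
    Complex.continuous_re.comp (continuous_standingWave h).curry_right
  have hmean := circularMean_eq_sineIntegral h hsource
  refine ⟨⟨_, hvert⟩, fun P hP => ?_⟩
  have hwave (ξ) : EqOn (P ξ) (fun t => (standingWave h t ξ).re) (Ioi 0) :=
    fun t ht => hP.unique hvert (le_of_lt ht) ξ
  refine ⟨(isClassicalWaveSolution_re_standingWave h hsource).congr
    fun ξ t ht => hP.unique hvert ht ξ, fun ξ r hr => ⟨?_, ?_, ?_, ?_⟩, fun m₁ hm => ?_⟩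
  · exact integrable_abelIntegrand (hcont ξ) hr (hwave ξ)
  · rw [hmean, abelTransform_eq (hcont ξ) hr (hwave ξ)]
    field_simp
  · exact intervalIntegrable_div_sqrt (hcont ξ) hr (hwave ξ)
  · rw [hmean, integral_div_sqrt hr (hwave ξ)]
  · have hdata (ξ : S) : EqOn (m₁ ξ) (fun t => (standingWave h t ξ).re) (Ioi 0) :=
      EqOn.trans (hm ξ) (hwave ξ)
    refine ⟨fun ξ r hr => ⟨intervalIntegrable_div_sqrt (hcont ξ) hr (hdata ξ), ?_⟩,
      fun ξ t ht => ?_⟩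
    · rw [hmean, integral_div_sqrt hr (hdata ξ)]
    · simp only [hmean]
      exact hasDerivAt_integral_mul_sineIntegral_div_sqrt (hcont ξ) (hdata ξ) ht

theorem mainTheorem4 (Ω : Set Photoacoustic.Plane) (hΩ_open : IsOpen Ω) (hΩ_convex : Convex ℝ Ω)
    (f : Photoacoustic.Plane → ℝ) (hf : ContDiff ℝ ∞ f) (hf_compact : HasCompactSupport f)
    (hf_supp : tsupport f ⊆ Ω)
    (p : ℝ → 𝓢'(Photoacoustic.Space3, ℂ))
    (hp : Photoacoustic.IsDistributionalWaveSolution p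
      (Photoacoustic.planarSource f hf hf_compact)) :
    -- the vertically integrated pressure exists
    (∃ P : Photoacoustic.Plane → ℝ → ℝ, Photoacoustic.IsVerticallyIntegrated p P) ∧
    ∀ P : Photoacoustic.Plane → ℝ → ℝ, Photoacoustic.IsVerticallyIntegrated p P →
      -- it solves the two-dimensional wave equation
      Photoacoustic.IsClassicalWaveSolution P f ∧
      -- the circular means of the initial data, at all points of the plane
      (∀ ξ : Photoacoustic.Plane, ∀ r : ℝ, 0 < r →
        MeasureTheory.Integrable
          (fun u : ℝ => P ξ (1 / Real.sqrt (u ^ 2 + (1 / r) ^ 2)) /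
            Real.sqrt (u ^ 2 + (1 / r) ^ 2) ^ 2) ∧
        Photoacoustic.circularMean f ξ r =
          1 / (Real.pi * r) *
            Photoacoustic.abelTransform (fun s => P ξ (1 / s) / s ^ 2) (1 / r) ∧
        IntervalIntegrable (fun t => P ξ t / Real.sqrt (r ^ 2 - t ^ 2))
          MeasureTheory.volume 0 r ∧
        Photoacoustic.circularMean f ξ r =
          2 / Real.pi * ∫ t in (0 : ℝ)..r, P ξ t / Real.sqrt (r ^ 2 - t ^ 2)) ∧
      -- the line detector data determine the circular means centred on the boundary, and conversely
      ∀ m₁ : frontier Ω → ℝ → ℝ, (∀ ξ : frontier Ω, ∀ t : ℝ, 0 < t → m₁ ξ t = P ξ t) →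
        (∀ ξ : frontier Ω, ∀ r : ℝ, 0 < r →
          IntervalIntegrable (fun t => m₁ ξ t / Real.sqrt (r ^ 2 - t ^ 2))
            MeasureTheory.volume 0 r ∧
          Photoacoustic.circularMean f ξ r =
            2 / Real.pi * ∫ t in (0 : ℝ)..r, m₁ ξ t / Real.sqrt (r ^ 2 - t ^ 2)) ∧
        (∀ ξ : frontier Ω, ∀ t : ℝ, 0 < t →
          HasDerivAt
            (fun τ : ℝ => ∫ r in (0 : ℝ)..τ,
              r * Photoacoustic.circularMean f ξ r / Real.sqrt (τ ^ 2 - r ^ 2))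
            (m₁ ξ t) t) :=
  mainTheorem4_general (frontier Ω) f hf hf_compact p hp
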